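/- There is an absolute constant $C>0$ such that the following holds. Let $d,K$ be natural numbers with $K\ge d$, let $I_{\vec a}$ be the unit mass at $\vec a\in\mathbb R^d$, $I=I_{\vec 0}$, and let $F$ be a probability distribution on $\mathbb R^d$ of the form $$F=qI+\sum_{m=1}^K p_mF_m,\qquad q,p_1,\dots,p_K\in(0,1),\qquad \sum_{m=1}^K p_m=1-q,$$ where $F_1,\dots,F_K$ are probability distributions on $\mathbb R^d$ and $\vec y_1,\dots,\vec y_K\in\mathbb R^d$ are non-zero vectors such that: (i) $\mathrm{supp}\,F_m\subset\{k\vec y_m: k\in\mathbb Z\setminus\{0\}\}$ for every $m$, and $\mathrm{supp}\,F_m\cap\mathrm{supp}\,F_k=\emptyset$ for $k\ne m$; (ii) $F_m\{k\vec y_m\}=F_m\{-k\vec y_m\}$ for all $k\in\{1,2,\dots\}$ and every $m$; (iii) for every $m$ there is an integer $k_m^0$ with $F_m\{k_m^0\vec y_m\}>0$ and $F_m\{(k_m^0+1)\vec y_m\}>0$; (iv) the variances $\sigma_m^2=\sum_{k\in\mathbb Z}k^2F_m\{k\vec y_m\}$ are finite ($\sigma_m\ge 0$). Then, for every integer $n\ge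 1$, $$d\bigl(F^{*n},\exp\{n(F-I)\}\bigr)\le\frac{1.76}{n}\Bigl(\sum_{m=1}^K\sqrt{1+\sigma_m}\Bigr)^2\Bigl(1+\frac{C}{\sqrt n\,q^5}\sum_{m=1}^K\sqrt{1+\sigma_m}\Bigr).$$ Here, for finite signed measures on $\mathbb R^d$, $*$ is convolution, $M^{*j}$ is the $j$-fold convolution power with $M^{*0}=I$, $\exp\{M\}=\sum_{j\ge 0}M^{*j}/j!$, and $d(M,V)=\sup_B|M\{B\}-V\{B\}|$ is the total variation distance, the supremum being over all Borel sets $B\subset\mathbb R^d$. -/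

import Mathlib

open MeasureTheory
open scoped ENNReal Nat

noncomputable section

namespace ConvExp

section Algebra

variable {E : Type*} [AddMonoid E] [MeasurableSpace E]

/-- A finite signed measure has finite variation. -/
instance isFiniteMeasure_variation (M : SignedMeasure E) : IsFiniteMeasure M.variation := by
  rw [← SignedMeasure.totalVariation_eq_variation]
  infer_instance

/-- Convolution `M * V` of finite signed measures: the image of the product measure under
addition. -/
def conv (M V : SignedMeasure E) : SignedMeasure E :=
  (M.prod V (ContinuousLinearMap.mul ℝ ℝ)).map (fun z : E × E => z.1 + z.2)

/-- The unit mass `I_a` at the point `a`, as a signed measure. -/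
def unitMass (a : E) : SignedMeasure E := (Measure.dirac a).toSignedMeasure

/-- Convolution powers `M^{*j}`, with `M^{*0} = I`, the unit mass at the origin. -/
def convPow (M : SignedMeasure E) : ℕ → SignedMeasure E
  | 0 => unitMass 0
  | j + 1 => conv (convPow M j) M

theorem variation_conv_univ_le (M V : SignedMeasure E) :
    (conv M V).variation Set.univ ≤ M.variation Set.univ * V.variation Set.univ := by
  by_cases hadd : Measurable (fun z : E × E => z.1 + z.2)
  · calc (conv M V).variation Set.univ
        ≤ ((M.prod V (ContinuousLinearMap.mul ℝ ℝ)).variation.map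
            (fun z : E × E => z.1 + z.2)) Set.univ := VectorMeasure.variation_map_le _
      _ = (M.prod V (ContinuousLinearMap.mul ℝ ℝ)).variation Set.univ := by
          rw [Measure.map_apply hadd MeasurableSet.univ, Set.preimage_univ]
      _ ≤ (‖ContinuousLinearMap.mul ℝ ℝ‖ₑ • M.variation.prod V.variation) Set.univ :=
          VectorMeasure.variation_prod_le _
      _ = M.variation Set.univ * V.variation Set.univ := by
          rw [Measure.smul_apply, ← Set.univ_prod_univ, Measure.prod_prod]
          simp [enorm]
  · have : conv M V = 0 := VectorMeasure.map_not_measurable _ hadd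
    simp [this]

theorem variation_convPow_univ_le (M : SignedMeasure E) (j : ℕ) :
    (convPow M j).variation Set.univ ≤ (M.variation Set.univ) ^ j := by
  induction j with
  | zero => simp [convPow, unitMass]
  | succ j ih =>
    rw [pow_succ]
    exact (variation_conv_univ_le _ _).trans (mul_le_mul_left ih _)

set_option linter.unusedSectionVars false in
theorem tsum_abs_le_variation (M : SignedMeasure E) {f : ℕ → Set E}
    (hf : ∀ i, MeasurableSet (f i)) (hd : Pairwise (Function.onFun Disjoint f)) :
    ∑' i, |M (f i)| ≤ M.variation.real Set.univ := by
  have h1 : HasSum (fun i => M.variation.real (f i)) (M.variation.real (⋃ i, f i)) :=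
    by
      have h := (summable_measure_toReal (μ := M.variation) hf hd).hasSum
      simp only [measureReal_def] at h ⊢
      rwa [measure_iUnion hd hf, ENNReal.tsum_toReal_eq fun i => measure_ne_top _ _]
  refine ((M.m_iUnion hf hd).summable.abs.tsum_le_tsum (fun i => ?_) h1.summable).trans ?_
  · rw [← Real.norm_eq_abs]
    exact VectorMeasure.norm_measure_le_variation (measure_ne_top _ _)
  · rw [h1.tsum_eq]
    exact measureReal_mono (Set.subset_univ _)

/-- The exponential measure `exp{M} = ∑_{j ≥ 0} M^{*j} / j!` of a finite signed measure `M`. -/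
def expMeasure (M : SignedMeasure E) : SignedMeasure E where
  measureOf' B := ∑' j : ℕ, convPow M j B / (j ! : ℝ)
  empty' := by simp
  not_measurable' B hB := by simp [VectorMeasure.not_measurable _ hB]
  m_iUnion' f hf hd := by
    have hrow : ∀ j : ℕ, HasSum (fun i => convPow M j (f i) / (j ! : ℝ))
        (convPow M j (⋃ i, f i) / (j ! : ℝ)) := fun j =>
      ((convPow M j).m_iUnion hf hd).div_const _
    have hS : Summable (fun z : ℕ × ℕ => convPow M z.1 (f z.2) / (z.1 ! : ℝ)) := by
      apply Summable.of_abs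
      rw [summable_prod_of_nonneg (fun _ => abs_nonneg _)]
      refine ⟨fun j => (hrow j).summable.abs, ?_⟩
      refine Summable.of_nonneg_of_le (fun j => tsum_nonneg fun _ => abs_nonneg _) (fun j => ?_)
        (Real.summable_pow_div_factorial (M.variation.real Set.univ))
      simp only [abs_div, Nat.abs_cast, tsum_div_const]
      gcongr
      refine (tsum_abs_le_variation _ hf hd).trans ?_
      rw [measureReal_def, measureReal_def, ← ENNReal.toReal_pow]
      exact ENNReal.toReal_mono (by finiteness) (variation_convPow_univ_le M j)
    have h1 := hS.hasSum.prod_fiberwise hrow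
    have hS' := (Equiv.prodComm ℕ ℕ).summable_iff.2 hS
    have h2 := hS'.hasSum.prod_fiberwise (fun i => (hS'.prod_factor i).hasSum)
    have h3 := (Equiv.prodComm ℕ ℕ).tsum_eq
      (fun z : ℕ × ℕ => convPow M z.1 (f z.2) / (z.1 ! : ℝ))
    rw [h1.tsum_eq, ← h3]
    exact h2

end Algebra

/-- Total variation distance `d(M, V) = sup_B |M(B) - V(B)|` over all measurable sets `B`. -/
def tvDist {E : Type*} [MeasurableSpace E] (M V : SignedMeasure E) : ℝ :=
  ⨆ B : {B : Set E // MeasurableSet B}, |M B - V B|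

/-- The standard deviation `σ` of the integer variable `Y` with `P(Y = k) = μ{k y}`, that is
`σ² = ∑_{k ∈ ℤ} k² μ{k y}`; it is meaningful when this series converges. -/
def lineSigma {d : ℕ} (μ : Measure (EuclideanSpace ℝ (Fin d))) (y : EuclideanSpace ℝ (Fin d)) : ℝ :=
  √(∑' k : ℤ, (k : ℝ) ^ 2 * μ.real {(k : ℝ) • y})

end ConvExp

end

namespace ConvExp

/-! Signed measures are represented by operators in the commutative Banach algebra generated by the
translations of bounded functions: `x` represents `M` when `M B` is the value at the origin of `x`
applied to the indicator of `B`. Convolution becomes multiplication, and two measures of equal total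
mass are at distance at most half the norm of the difference of their operators (`tvDist_le_norm`).
The law `F` becomes `1 + W` with `W = ∑ p_m (X_m - 1)`, where `X_m` is a Laurent series with the
weights of `F_m` in the translation by `y_m`. What remains is to bound `(1 + W)^n - exp(nW)` in
norm.

To second order this difference is `-(n/2) W² exp(nW)`, which equals `-(n/2) (W exp(nW/2))²`; the
error terms contain `W³` or `W⁴` next to about `n` factors `1 + W` or `exp W` (`norm_expansion_le`).
So everything rests on smoothing bounds: `W exp(tW)` is at most `√1.76 S / t`, with `S = ∑ √(1 +
σ_m)`, which gives the leading constant, and `W (1 + W)^i` is `O(S / (q^{3/2} (i + 1)))`, which is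
enough for the errors.

By the triangle inequality smoothing reduces to one direction at a time, since the other directions
contribute contractions. In one direction, a power series in `X_m` is a Laurent series whose
coefficients are the Fourier coefficients of the same power series evaluated at the characteristic
function `φ` of the weights. Their `ℓ¹` norm is bounded by a weighted Cauchy–Schwarz inequality and
Parseval for the function and its derivative (`IsStep.sq_tsum_abs_le`). Two facts about `φ` enter:
`φ'² ≤ 2σ²(1 - φ)`, and `∫ exp(-l(1 - φ)) = O(l^{-1/2})` uniformly over all symmetric weights
without mass at zero, which follows from Jensen's inequality. -/

/-! ### Symmetric lattice weights and their characteristic function. -/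

/-- The weights of a symmetric probability distribution on `ℤ \ {0}` with finite variance. -/
structure IsStep (a : ℤ → ℝ) : Prop where
  nonneg : ∀ k, 0 ≤ a k
  hasSum : HasSum a 1
  zero : a 0 = 0
  symm : ∀ k, a (-k) = a k
  summable_sq : Summable fun k : ℤ => (k : ℝ) ^ 2 * a k

/-- The standard deviation of the weights `a`. -/
noncomputable def stepSigma (a : ℤ → ℝ) : ℝ := √(∑' k : ℤ, (k : ℝ) ^ 2 * a k)

/-- The cosine series of the weights `a`, that is, their characteristic function. -/
noncomputable def cosSum (a : ℤ → ℝ) (t : ℝ) : ℝ := ∑' k : ℤ, a k * Real.cos (k * t)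

/-- The termwise derivative of the cosine series. -/
noncomputable def cosSumDeriv (a : ℤ → ℝ) (t : ℝ) : ℝ := ∑' k : ℤ, a k * -(k * Real.sin (k * t))

/-- On `[-π, π]` one has `1 - cos x ≥ 2x²/π²`, so a Gaussian dominates the integrand. -/
theorem integral_exp_cos_le {l : ℝ} (hl : 0 < l) :
    ∫ x in (-Real.pi)..Real.pi, Real.exp (-l * (1 - Real.cos x)) ≤
      Real.pi * √(Real.pi / (2 * l)) := by
  have hpi := Real.pi_pos
  have hb : 0 < 2 * l / Real.pi ^ 2 := by positivity
  calc ∫ x in (-Real.pi)..Real.pi, Real.exp (-l * (1 - Real.cos x))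
      ≤ ∫ x in (-Real.pi)..Real.pi, Real.exp (-(2 * l / Real.pi ^ 2) * x ^ 2) := by
        apply intervalIntegral.integral_mono_on (by linarith)
        · exact Continuous.intervalIntegrable (by fun_prop) _ _
        · exact Continuous.intervalIntegrable (by fun_prop) _ _
        · intro x hx
          have h := Real.cos_le_one_sub_mul_cos_sq (x := x) (abs_le.2 ⟨hx.1, hx.2⟩)
          apply Real.exp_le_exp.2
          have : l * (2 / Real.pi ^ 2 * x ^ 2) ≤ l * (1 - Real.cos x) := by gcongr; linarith
          calc _ ≤ -(l * (2 / Real.pi ^ 2 * x ^ 2)) := by linarith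
            _ = _ := by ring
    _ ≤ ∫ x, Real.exp (-(2 * l / Real.pi ^ 2) * x ^ 2) := by
        rw [intervalIntegral.integral_of_le (by linarith)]
        exact setIntegral_le_integral (integrable_exp_neg_mul_sq hb)
          (Filter.Eventually.of_forall fun x => (Real.exp_pos _).le)
    _ = Real.pi * √(Real.pi / (2 * l)) := by
        rw [integral_gaussian]
        rw [show Real.pi / (2 * l / Real.pi ^ 2) = Real.pi ^ 2 * (Real.pi / (2 * l)) by field_simp]
        rw [Real.sqrt_mul (by positivity), Real.sqrt_sq hpi.le]

theorem integral_comp_int_mul {g : ℝ → ℝ} (hper : Function.Periodic g (2 * Real.pi))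
    (hc : Continuous g)
    {k : ℤ} (hk : k ≠ 0) :
    ∫ x in (-Real.pi)..Real.pi, g (k * x) = ∫ x in (-Real.pi)..Real.pi, g x := by
  have hk' : (k : ℝ) ≠ 0 := by exact_mod_cast hk
  rw [intervalIntegral.integral_comp_mul_left _ hk']
  have h := hper.intervalIntegral_add_zsmul_eq k (k * -Real.pi)
    fun t₁ t₂ => hc.intervalIntegrable _ _
  have e : (k : ℝ) * -Real.pi + k • (2 * Real.pi) = k * Real.pi := by rw [zsmul_eq_mul]; ring
  rw [e] at h
  rw [h]
  have h0 := hper.intervalIntegral_add_eq (k * -Real.pi) (-Real.pi)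
  rw [show -Real.pi + 2 * Real.pi = Real.pi by ring] at h0
  rw [h0]
  simp [hk']

namespace IsStep

variable {a : ℤ → ℝ}

theorem summable_cos (ha : IsStep a) (t : ℝ) : Summable fun k : ℤ => a k * Real.cos (k * t) := by
  refine Summable.of_norm_bounded ha.hasSum.summable fun k => ?_
  rw [Real.norm_eq_abs, abs_mul, abs_of_nonneg (ha.nonneg k)]
  exact mul_le_of_le_one_right (ha.nonneg k) (Real.abs_cos_le_one _)

theorem hasSum_one_sub_cos (ha : IsStep a) (t : ℝ) :
    HasSum (fun k : ℤ => a k * (1 - Real.cos (k * t))) (1 - cosSum a t) := by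
  have := ha.hasSum.sub (ha.summable_cos t).hasSum
  simpa [mul_sub, cosSum] using this

theorem cosSum_le_one (ha : IsStep a) (t : ℝ) : cosSum a t ≤ 1 := by
  have := (ha.hasSum_one_sub_cos t).nonneg fun k =>
    mul_nonneg (ha.nonneg k) (by linarith [Real.cos_le_one (k * t)])
  linarith

theorem neg_one_le_cosSum (ha : IsStep a) (t : ℝ) : -1 ≤ cosSum a t := by
  have h := ha.hasSum.add (ha.summable_cos t).hasSum
  have := h.nonneg fun k => by
    have h1 := ha.nonneg k
    have h2 := Real.neg_one_le_cos (k * t)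
    nlinarith
  have e : cosSum a t = ∑' k : ℤ, a k * Real.cos (k * t) := rfl
  linarith

theorem hasSum_sq (ha : IsStep a) : HasSum (fun k : ℤ => (k : ℝ) ^ 2 * a k) (stepSigma a ^ 2) := by
  rw [stepSigma, Real.sq_sqrt]
  · exact ha.summable_sq.hasSum
  · exact tsum_nonneg fun k => mul_nonneg (sq_nonneg _) (ha.nonneg k)

/-- All the mass sits on integers with `k² ≥ 1`. This lower bound lets terms without `σ` be absorbed
into multiples of `1 + σ`. -/
theorem one_le_sigma (ha : IsStep a) : 1 ≤ stepSigma a := by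
  have h : (1 : ℝ) ≤ stepSigma a ^ 2 := by
    refine hasSum_le (fun k => ?_) ha.hasSum ha.hasSum_sq
    rcases eq_or_ne k 0 with rfl | hk
    · simp [ha.zero]
    · have : (1 : ℝ) ≤ (k : ℝ) ^ 2 := by
        have : (1 : ℤ) ≤ k ^ 2 := Int.add_one_le_iff.2 (sq_pos_iff.2 hk)
        exact_mod_cast this
      nlinarith [ha.nonneg k]
  have h0 : 0 ≤ stepSigma a := Real.sqrt_nonneg _
  nlinarith

theorem summable_abs (ha : IsStep a) : Summable fun k : ℤ => |(k : ℝ)| * a k := by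
  refine Summable.of_nonneg_of_le (fun k => mul_nonneg (abs_nonneg _) (ha.nonneg k)) (fun k => ?_)
    (ha.hasSum.summable.add ha.summable_sq)
  have h1 := ha.nonneg k
  have : |(k : ℝ)| ≤ 1 + (k : ℝ) ^ 2 := by
    rw [← sq_abs]; nlinarith [sq_nonneg (|(k : ℝ)| - 1), abs_nonneg (k : ℝ)]
  nlinarith

theorem hasDerivAt_cosSum (ha : IsStep a) (t : ℝ) : HasDerivAt (cosSum a) (cosSumDeriv a t) t := by
  unfold cosSum cosSumDeriv
  refine hasDerivAt_tsum (u := fun k : ℤ => |(k : ℝ)| * a k) ha.summable_abs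
    (g := fun k t => a k * Real.cos (k * t)) (g' := fun k t => a k * -(k * Real.sin (k * t)))
    (fun k y => ?_) (fun k y => ?_) (ha.summable_cos 0) t
  · have h := ((Real.hasDerivAt_cos (k * y)).comp y ((hasDerivAt_id y).const_mul (k : ℝ))).const_mul
      (a k)
    refine h.congr_deriv ?_
    ring
  · rw [Real.norm_eq_abs, abs_mul, abs_of_nonneg (ha.nonneg k), abs_neg, abs_mul]
    calc _ ≤ a k * (|(k : ℝ)| * 1) := by
          gcongr
          · exact ha.nonneg k
          · exact Real.abs_sin_le_one _
      _ = _ := by ring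

theorem continuous_cosSum (ha : IsStep a) : Continuous (cosSum a) :=
  continuous_iff_continuousAt.2 fun t => (ha.hasDerivAt_cosSum t).continuousAt

theorem continuous_cosSumDeriv (ha : IsStep a) : Continuous (cosSumDeriv a) := by
  unfold cosSumDeriv
  refine continuous_tsum (u := fun k : ℤ => |(k : ℝ)| * a k) (fun k => by fun_prop) ha.summable_abs
    fun k y => ?_
  rw [Real.norm_eq_abs, abs_mul, abs_of_nonneg (ha.nonneg k), abs_neg, abs_mul]
  calc _ ≤ a k * (|(k : ℝ)| * 1) := by
        gcongr
        · exact ha.nonneg k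
        · exact Real.abs_sin_le_one _
    _ = _ := by ring

/-- Cauchy–Schwarz for the weights `a`, applied to `k` and `sin(kt)`, together with `sin² ≤ 2(1 -
cos)`. The inequality is first proved in its polarised form, for every multiplier `u`. -/
theorem cosSumDeriv_sq_le (ha : IsStep a) (t : ℝ) :
    cosSumDeriv a t ^ 2 ≤ 2 * stepSigma a ^ 2 * (1 - cosSum a t) := by
  set z := 1 - cosSum a t
  have hz : 0 ≤ z := by simp only [z]; linarith [ha.cosSum_le_one t]
  have hs := ha.one_le_sigma
  set s := stepSigma a
  have hS : Summable fun k : ℤ => a k * -(k * Real.sin (k * t)) := by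
    refine Summable.of_norm_bounded ha.summable_abs fun k => ?_
    rw [Real.norm_eq_abs, abs_mul, abs_of_nonneg (ha.nonneg k), abs_neg, abs_mul]
    calc _ ≤ a k * (|(k : ℝ)| * 1) := by
          gcongr
          · exact ha.nonneg k
          · exact Real.abs_sin_le_one _
      _ = _ := by ring
  have key : ∀ u : ℝ, 2 * u * cosSumDeriv a t ≤ s ^ 2 + u ^ 2 * (2 * z) := by
    intro u
    have h1 : HasSum (fun k : ℤ => 2 * u * (a k * -(k * Real.sin (k * t))))
      (2 * u * cosSumDeriv a t) := hS.hasSum.mul_left _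
    have h2 := ha.hasSum_sq.add (((ha.hasSum_one_sub_cos t).mul_left 2).mul_left (u ^ 2))
    refine hasSum_le (fun k => ?_) h1 h2
    have hc : Real.sin (k * t) ^ 2 ≤ 2 * (1 - Real.cos (k * t)) := by
      nlinarith [Real.sin_sq_add_cos_sq (k * t), sq_nonneg (1 - Real.cos (k * t))]
    have hk := ha.nonneg k
    have : 2 * u * -(k * Real.sin (k * t)) ≤ (k : ℝ) ^ 2 +
        u ^ 2 * (2 * (1 - Real.cos (k * t))) := by
      nlinarith [sq_nonneg ((k : ℝ) + u * Real.sin (k * t)),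
        mul_le_mul_of_nonneg_left hc (sq_nonneg u)]
    nlinarith [mul_le_mul_of_nonneg_left this hk]
  rcases hz.eq_or_lt with h0 | h0
  · rw [← h0]
    have hD : cosSumDeriv a t = 0 := by
      by_contra hne
      -- With `z = 0` the bound is linear in `u`, and this `u` would give `2s² ≤ s²`.
      have := key (s ^ 2 / cosSumDeriv a t)
      rw [← h0, show 2 * (s ^ 2 / cosSumDeriv a t) * cosSumDeriv a t = 2 * s ^ 2 by
        field_simp] at this
      nlinarith
    simp [hD]
  · have := key (cosSumDeriv a t / (2 * z))
    field_simp at this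
    nlinarith

/-- Jensen's inequality for the exponential of the cosine series. -/
theorem exp_cosSum_le (ha : IsStep a) (l t : ℝ) :
    Real.exp (-l * (1 - cosSum a t)) ≤ ∑' k : ℤ, a k * Real.exp (-l * (1 - Real.cos (k * t))) := by
  set z := 1 - cosSum a t with hz
  have hs : Summable fun k : ℤ => a k * Real.exp (-l * (1 - Real.cos (k * t))) := by
    refine Summable.of_norm_bounded (ha.hasSum.summable.mul_right (Real.exp (2 * |l|))) fun k => ?_
    rw [Real.norm_eq_abs, abs_mul, abs_of_nonneg (ha.nonneg k), Real.abs_exp]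
    refine mul_le_mul_of_nonneg_left (Real.exp_le_exp.2 ?_) (ha.nonneg k)
    have h1 := Real.neg_one_le_cos (k * t)
    have h2 := Real.cos_le_one (k * t)
    nlinarith [neg_abs_le l, le_abs_self l, abs_nonneg l]
  -- The tangent line to the exponential at `-l z`, averaged over the weights: its mean is exactly
  -- `exp(-l z)`, because `z` is the mean of `1 - cos(kt)`.
  have h1 : HasSum (fun k : ℤ => Real.exp (-l * z) *
      (a k * (1 + l * z) + -l * (a k * (1 - Real.cos (k * t)))))
      (Real.exp (-l * z) * (1 * (1 + l * z) + -l * z)) :=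
    ((ha.hasSum.mul_right _).add ((ha.hasSum_one_sub_cos t).mul_left _)).mul_left _
  have h2 : Real.exp (-l * z) = Real.exp (-l * z) * (1 * (1 + l * z) + -l * z) := by ring
  rw [h2]
  refine hasSum_le (fun k => ?_) h1 hs.hasSum
  have h3 := Real.add_one_le_exp (-l * (1 - Real.cos (k * t)) + l * z)
  have h4 : Real.exp (-l * (1 - Real.cos (k * t))) =
    Real.exp (-l * z) * Real.exp (-l * (1 - Real.cos (k * t)) + l * z) := by
    rw [← Real.exp_add]; ring_nf
  rw [h4]
  have h5 := mul_le_mul_of_nonneg_left h3 (mul_nonneg (ha.nonneg k) (Real.exp_pos (-l * z)).le)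
  linarith

theorem integral_exp_cosSum_le (ha : IsStep a) {l : ℝ} (hl : 0 < l) :
    ∫ t in (-Real.pi)..Real.pi, Real.exp (-l * (1 - cosSum a t)) ≤
      Real.pi * √(Real.pi / (2 * l)) := by
  have hpi := Real.pi_pos
  have hcont := ha.continuous_cosSum
  have hb : ∀ (k : ℤ) (t : ℝ), ‖a k * Real.exp (-l * (1 - Real.cos (k * t)))‖ ≤ a k := by
    intro k t
    rw [Real.norm_eq_abs, abs_mul, abs_of_nonneg (ha.nonneg k), Real.abs_exp]
    refine mul_le_of_le_one_right (ha.nonneg k) (Real.exp_le_one_iff.2 ?_)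
    nlinarith [Real.cos_le_one (k * t)]
  have hc : Continuous fun t : ℝ => ∑' k : ℤ, a k * Real.exp (-l * (1 - Real.cos (k * t))) :=
    continuous_tsum (fun k => by fun_prop) ha.hasSum.summable hb
  have hsum : HasSum (fun k : ℤ => ∫ t in (-Real.pi)..Real.pi,
      a k * Real.exp (-l * (1 - Real.cos (k * t))))
      (∫ t in (-Real.pi)..Real.pi, ∑' k : ℤ, a k * Real.exp (-l * (1 - Real.cos (k * t)))) := by
    refine intervalIntegral.hasSum_integral_of_dominated_convergence (fun k _ => a k)
      (fun k => Continuous.aestronglyMeasurable (by fun_prop))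
      (fun k => Filter.Eventually.of_forall fun t _ => hb k t)
      (Filter.Eventually.of_forall fun t _ => ha.hasSum.summable)
      intervalIntegrable_const (Filter.Eventually.of_forall fun t _ => ?_)
    exact (Summable.of_norm_bounded ha.hasSum.summable fun k => hb k t).hasSum
  calc _ ≤ ∫ t in (-Real.pi)..Real.pi, ∑' k : ℤ, a k * Real.exp (-l * (1 - Real.cos (k * t))) := by
        apply intervalIntegral.integral_mono_on (by linarith)
        · exact Continuous.intervalIntegrable (by fun_prop) _ _
        · exact hc.intervalIntegrable _ _
        · exact fun t _ => ha.exp_cosSum_le l t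
    _ ≤ 1 * (Real.pi * √(Real.pi / (2 * l))) := by
        refine hasSum_le (fun k => ?_) hsum (ha.hasSum.mul_right _)
        rw [intervalIntegral.integral_const_mul]
        -- By periodicity every `k ≠ 0` gives the same integral as `k = 1`, and `k = 0` carries no
        -- weight; hence a bound independent of `a`.
        rcases eq_or_ne k 0 with rfl | hk
        · simp [ha.zero]
        · refine mul_le_mul_of_nonneg_left ?_ (ha.nonneg k)
          rw [integral_comp_int_mul (g := fun x => Real.exp (-l * (1 - Real.cos x))) ?_ ?_ hk]
          · exact integral_exp_cos_le hl
          · intro x; simp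
          · fun_prop
    _ = _ := one_mul _

end IsStep

/-! ### Fourier coefficients and their `ℓ¹` norm. -/

theorem fourier_symm_interval (k : ℤ) (t : ℝ) :
    fourier k (t : AddCircle (Real.pi - -Real.pi)) = Complex.exp (k * t * Complex.I) := by
  rw [fourier_coe_apply]
  congr 1
  have : (Real.pi : ℂ) ≠ 0 := by exact_mod_cast Real.pi_ne_zero
  push_cast
  field_simp
  ring

theorem neg_pi_lt_pi : -Real.pi < Real.pi := by linarith [Real.pi_pos]

/-- An absolutely convergent trigonometric series is the Fourier series of its sum. -/
theorem fourierCoeffOn_of_hasSum {c : ℤ → ℂ} (hc : Summable fun k => ‖c k‖) {h : ℝ → ℂ}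
    (hh : ∀ t : ℝ, HasSum (fun k : ℤ => c k * Complex.exp (k * t * Complex.I)) (h t)) (k : ℤ) :
    fourierCoeffOn neg_pi_lt_pi h k = c k := by
  have hpi := Real.pi_pos
  rw [fourierCoeffOn_eq_integral]
  have hsum : HasSum (fun j : ℤ => ∫ t in (-Real.pi)..Real.pi,
      fourier (-k) (t : AddCircle (Real.pi - -Real.pi)) •
        (c j * Complex.exp (j * t * Complex.I)))
      (∫ t in (-Real.pi)..Real.pi,
        fourier (-k) (t : AddCircle (Real.pi - -Real.pi)) • h t) := by
    refine intervalIntegral.hasSum_integral_of_dominated_convergence (fun j _ => ‖c j‖)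
      (fun j => ?_) (fun j => Filter.Eventually.of_forall fun t _ => ?_)
      (Filter.Eventually.of_forall fun t _ => hc)
      intervalIntegrable_const (Filter.Eventually.of_forall fun t _ => (hh t).const_smul _)
    · simp only [fourier_symm_interval]
      exact Continuous.aestronglyMeasurable (by fun_prop)
    · rw [fourier_symm_interval, norm_smul, norm_mul]
      have e : ∀ n : ℤ, ‖Complex.exp (n * t * Complex.I)‖ = 1 := fun n => by
        have := Complex.norm_exp_ofReal_mul_I (n * t)
        push_cast at this
        exact this
      rw [e, e]; simp
  have hint : ∀ j : ℤ, ∫ t in (-Real.pi)..Real.pi,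
      fourier (-k) (t : AddCircle (Real.pi - -Real.pi)) • (c j * Complex.exp (j * t * Complex.I))
      = if j = k then (2 * Real.pi) * c k else 0 := by
    intro j
    have e : ∀ t : ℝ, fourier (-k) (t : AddCircle (Real.pi - -Real.pi)) •
        (c j * Complex.exp (j * t * Complex.I)) =
        c j * Complex.exp (((j - k : ℤ) : ℂ) * Complex.I * t) := by
      intro t
      rw [fourier_symm_interval, smul_eq_mul, mul_left_comm, ← Complex.exp_add]
      congr 2; push_cast; ring
    simp only [e, intervalIntegral.integral_const_mul]
    split_ifs with hjk
    · subst hjk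
      simp
      ring
    · have hne : ((j - k : ℤ) : ℂ) * Complex.I ≠ 0 := by
        simp [sub_eq_zero, hjk]
      rw [integral_exp_mul_complex hne]
      have : Complex.exp (((j - k : ℤ) : ℂ) * Complex.I * (Real.pi : ℝ)) =
          Complex.exp (((j - k : ℤ) : ℂ) * Complex.I * ((-Real.pi : ℝ) : ℂ)) := by
        rw [Complex.exp_eq_exp_iff_exists_int]
        exact ⟨j - k, by push_cast; ring⟩
      rw [this]; simp
  simp only [hint] at hsum
  rw [← hsum.tsum_eq, tsum_ite_eq]
  have : (Real.pi : ℂ) ≠ 0 := by exact_mod_cast Real.pi_ne_zero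
  rw [Complex.real_smul]
  push_cast
  field_simp
  ring

/-- Parseval's identity, for a function and its derivative. -/
theorem hasSum_sq_coeff {c : ℤ → ℝ} (hc : Summable fun k => |c k|) {h h' : ℝ → ℝ}
    (hh : ∀ t : ℝ, HasSum (fun k : ℤ => (c k : ℂ) * Complex.exp (k * t * Complex.I)) (h t))
    (hd : ∀ t, HasDerivAt h (h' t) t) (hcont : Continuous h') :
    HasSum (fun k => c k ^ 2) ((2 * Real.pi)⁻¹ * ∫ t in (-Real.pi)..Real.pi, h t ^ 2) ∧
    HasSum (fun k : ℤ => (k : ℝ) ^ 2 * c k ^ 2)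
      ((2 * Real.pi)⁻¹ * ∫ t in (-Real.pi)..Real.pi, h' t ^ 2) := by
  have hch : Continuous h := continuous_iff_continuousAt.2 fun t => (hd t).continuousAt
  have hL : ∀ g : ℝ → ℝ, Continuous g → MemLp (fun t => (g t : ℂ)) 2
      (volume.restrict (Set.Ioc (-Real.pi) Real.pi)) := by
    intro g hg
    obtain ⟨C, hC⟩ := isCompact_Icc.exists_bound_of_continuousOn (s := Set.Icc (-Real.pi) Real.pi)
      (Complex.continuous_ofReal.comp hg).continuousOn
    refine MemLp.of_bound (Complex.continuous_ofReal.comp hg).aestronglyMeasurable C ?_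
    filter_upwards [ae_restrict_mem measurableSet_Ioc] with t ht
    exact hC t ⟨ht.1.le, ht.2⟩
  have hcoef := fourierCoeffOn_of_hasSum (c := fun k => (c k : ℂ)) (by simpa using hc) hh
  have hcoef' : ∀ k : ℤ, ‖fourierCoeffOn neg_pi_lt_pi (fun t => (h' t : ℂ)) k‖ ^ 2 =
      (k : ℝ) ^ 2 * c k ^ 2 := by
    intro k
    -- Equal end values kill the boundary term when integrating by parts, so the derivative has
    -- coefficients `i k c_k`.
    have hper : h Real.pi = h (-Real.pi) := by
      have h1 := hh Real.pi
      have h2 := hh (-Real.pi)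
      have : (h Real.pi : ℂ) = h (-Real.pi) := by
        refine h1.unique ?_
        convert h2 using 3 with j
        rw [Complex.exp_eq_exp_iff_exists_int]
        exact ⟨j, by push_cast; ring⟩
      exact_mod_cast this
    rcases eq_or_ne k 0 with rfl | hk
    · rw [fourierCoeffOn_eq_integral]
      simp only [fourier_symm_interval]
      have : ∫ t in (-Real.pi)..Real.pi, (h' t : ℂ) = 0 := by
        rw [intervalIntegral.integral_ofReal,
          intervalIntegral.integral_eq_sub_of_hasDerivAt (fun t _ => hd t)
            (hcont.intervalIntegrable _ _), hper]
        simp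
      simp [this]
    · have := fourierCoeffOn_of_hasDerivAt neg_pi_lt_pi (n := k) hk
        (f := fun t => (h t : ℂ)) (f' := fun t => (h' t : ℂ)) (fun t _ => (hd t).ofReal_comp)
        ((Complex.continuous_ofReal.comp hcont).intervalIntegrable _ _)
      rw [hcoef, hper, sub_self, mul_zero, zero_sub] at this
      have hpi : (Real.pi : ℂ) ≠ 0 := by exact_mod_cast Real.pi_ne_zero
      have hk' : (k : ℂ) ≠ 0 := by exact_mod_cast hk
      have e : fourierCoeffOn neg_pi_lt_pi (fun t => (h' t : ℂ)) k = Complex.I * k * c k := by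
        rw [this]
        push_cast
        field_simp
        ring
      rw [e, norm_mul, norm_mul, mul_pow, mul_pow]
      simp
  have p1 := hasSum_sq_fourierCoeffOn neg_pi_lt_pi (hL h hch)
  have p2 := hasSum_sq_fourierCoeffOn neg_pi_lt_pi (hL h' hcont)
  simp only [hcoef, hcoef'] at p1 p2
  have e2 : Real.pi - -Real.pi = 2 * Real.pi := by ring
  constructor
  · simpa [e2] using p1
  · simpa [e2] using p2

/-- Comparison with the integral of the Lorentzian `b² / (b² + x²)`. -/
theorem sum_lorentz_nat_le {b : ℝ} (hb : 0 < b) (N : ℕ) :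
    ∑ k ∈ Finset.range N, (1 + ((k : ℝ) + 1) ^ 2 / b ^ 2)⁻¹ ≤ b * Real.arctan (N / b) := by
  induction N with
  | zero => simp
  | succ N ih =>
    rw [Finset.sum_range_succ]
    have hlt : (N : ℝ) / b < (N + 1) / b := by gcongr; linarith
    obtain ⟨x, hx, hx'⟩ := exists_hasDerivAt_eq_slope Real.arctan (fun x => (1 + x ^ 2)⁻¹) hlt
      Real.continuous_arctan.continuousOn (fun x _ => by simpa using Real.hasDerivAt_arctan x)
    have h0 : 0 < x := lt_of_le_of_lt (by positivity) hx.1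
    have h1 : (1 + ((N : ℝ) + 1) ^ 2 / b ^ 2)⁻¹ ≤ (1 + x ^ 2)⁻¹ := by
      rw [← div_pow]
      gcongr
      exact hx.2.le
    rw [hx'] at h1
    have h2 : ((N : ℝ) + 1) / b - N / b = b⁻¹ := by field_simp; ring
    rw [h2, div_inv_eq_mul] at h1
    push_cast
    linarith

theorem sum_lorentz_le {b : ℝ} (hb : 0 < b) (s : Finset ℤ) :
    ∑ k ∈ s, (1 + (k : ℝ) ^ 2 / b ^ 2)⁻¹ ≤ 1 + Real.pi * b := by
  obtain ⟨N, hN⟩ : ∃ N : ℕ, s ⊆ Finset.Icc (-(N : ℤ)) N := by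
    refine ⟨s.sup Int.natAbs, fun k hk => ?_⟩
    have := Finset.le_sup (f := Int.natAbs) hk
    rw [Finset.mem_Icc]
    omega
  have hpos : ∀ k : ℤ, 0 ≤ (1 + (k : ℝ) ^ 2 / b ^ 2)⁻¹ := fun k => by positivity
  have hsym : ∀ N : ℕ, ∑ k ∈ Finset.Icc (-(N : ℤ)) N, (1 + (k : ℝ) ^ 2 / b ^ 2)⁻¹ =
      1 + 2 * ∑ k ∈ Finset.range N, (1 + ((k : ℝ) + 1) ^ 2 / b ^ 2)⁻¹ := by
    intro N
    induction N with
    | zero => simp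
    | succ N ih =>
      have e : Finset.Icc (-((N + 1 : ℕ) : ℤ)) ((N + 1 : ℕ) : ℤ) =
          insert (-((N : ℤ) + 1)) (insert ((N : ℤ) + 1) (Finset.Icc (-(N : ℤ)) N)) := by
        ext x; simp only [Finset.mem_Icc, Finset.mem_insert]; push_cast; omega
      rw [e, Finset.sum_insert (by simp; omega), Finset.sum_insert (by simp), ih,
        Finset.sum_range_succ]
      push_cast
      ring
  refine (Finset.sum_le_sum_of_subset_of_nonneg hN fun k _ _ => hpos k).trans ?_
  rw [hsym]
  have h1 := sum_lorentz_nat_le hb N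
  have h2 := Real.arctan_lt_pi_div_two (N / b)
  nlinarith

/-- The `ℓ¹` norm of the coefficients of a smooth function dominated by a power of the
characteristic function of a symmetric lattice distribution. -/
theorem IsStep.sq_tsum_abs_le {a : ℤ → ℝ} (ha : IsStep a) {c : ℤ → ℝ}
    (hc : Summable fun k => |c k|) {h h' : ℝ → ℝ}
    (hh : ∀ t : ℝ, HasSum (fun k : ℤ => (c k : ℂ) * Complex.exp (k * t * Complex.I)) (h t))
    (hd : ∀ t, HasDerivAt h (h' t) t) (hcont : Continuous h') {A B b l : ℝ} (hb : 0 < b)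
    (hl : 0 < l) (hA : ∀ t, h t ^ 2 ≤ A * Real.exp (-l * (1 - cosSum a t)))
    (hB : ∀ t, h' t ^ 2 ≤ B * Real.exp (-l * (1 - cosSum a t))) :
    (∑' k, |c k|) ^ 2 ≤ (1 + Real.pi * b) * ((A + B / b ^ 2) * (√(Real.pi / (2 * l)) / 2)) := by
  have hpi := Real.pi_pos
  obtain ⟨s1, s2⟩ := hasSum_sq_coeff hc hh hd hcont
  have hch : Continuous h := continuous_iff_continuousAt.2 fun t => (hd t).continuousAt
  have hca := ha.continuous_cosSum
  have bound : ∀ (g : ℝ → ℝ) (D : ℝ), Continuous g →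
      (∀ t, g t ^ 2 ≤ D * Real.exp (-l * (1 - cosSum a t))) →
      (2 * Real.pi)⁻¹ * ∫ t in (-Real.pi)..Real.pi, g t ^ 2 ≤ D * (√(Real.pi / (2 * l)) / 2) := by
    intro g D hg hD
    have hD0 : 0 ≤ D := by
      have := (sq_nonneg _).trans (hD 0)
      exact nonneg_of_mul_nonneg_left this (Real.exp_pos _)
    calc _ ≤ (2 * Real.pi)⁻¹ * (D * (Real.pi * √(Real.pi / (2 * l)))) := by
          gcongr
          refine le_trans ?_ (mul_le_mul_of_nonneg_left (ha.integral_exp_cosSum_le hl) hD0)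
          rw [← intervalIntegral.integral_const_mul]
          apply intervalIntegral.integral_mono_on (by linarith)
          · exact Continuous.intervalIntegrable (by fun_prop) _ _
          · exact Continuous.intervalIntegrable (by fun_prop) _ _
          · exact fun t _ => hD t
      _ = _ := by field_simp
  have b1 := bound h A hch hA
  have b2 := bound h' B hcont hB
  have hw : HasSum (fun k : ℤ => (1 + (k : ℝ) ^ 2 / b ^ 2) * c k ^ 2)
      (((2 * Real.pi)⁻¹ * ∫ t in (-Real.pi)..Real.pi, h t ^ 2) +
        (b ^ 2)⁻¹ * ((2 * Real.pi)⁻¹ * ∫ t in (-Real.pi)..Real.pi, h' t ^ 2)) := by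
    convert s1.add (s2.mul_left (b ^ 2)⁻¹) using 2 with k
    field_simp
  have hw' := hw.tsum_eq
  have hwle : ∑' k : ℤ, (1 + (k : ℝ) ^ 2 / b ^ 2) * c k ^ 2 ≤
      (A + B / b ^ 2) * (√(Real.pi / (2 * l)) / 2) := by
    rw [hw']
    calc _ ≤ A * (√(Real.pi / (2 * l)) / 2) + (b ^ 2)⁻¹ * (B * (√(Real.pi / (2 * l)) / 2)) := by
          gcongr
      _ = _ := by field_simp
  have hfin : ∀ s : Finset ℤ, ∑ k ∈ s, |c k| ≤
      √((1 + Real.pi * b) * ((A + B / b ^ 2) * (√(Real.pi / (2 * l)) / 2))) := by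
    intro s
    apply Real.le_sqrt_of_sq_le
    -- Cauchy–Schwarz with weight `1 + k²/b²`: the inverse weights sum to at most `1 + πb`, and the
    -- weighted squares are given by Parseval for `h` and `h'`. The scale `b` is free and is later
    -- taken of the order of the spread of the coefficients.
    calc (∑ k ∈ s, |c k|) ^ 2
        ≤ (∑ k ∈ s, (1 + (k : ℝ) ^ 2 / b ^ 2)⁻¹) *
            ∑ k ∈ s, (1 + (k : ℝ) ^ 2 / b ^ 2) * c k ^ 2 := by
          apply Finset.sum_sq_le_sum_mul_sum_of_sq_le_mul
          · intro k _; positivity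
          · intro k _; positivity
          · intro k _
            rw [sq_abs, inv_mul_cancel_left₀]
            positivity
      _ ≤ _ := by
          refine mul_le_mul (sum_lorentz_le hb s) ?_ ?_ (by positivity)
          · exact (hw.summable.sum_le_tsum s fun k _ => by positivity).trans hwle
          · exact Finset.sum_nonneg fun k _ => by positivity
  have h0 : 0 ≤ (1 + Real.pi * b) * ((A + B / b ^ 2) * (√(Real.pi / (2 * l)) / 2)) := by
    refine mul_nonneg (by positivity) (le_trans ?_ hwle)
    exact tsum_nonneg fun k => by positivity
  rw [← Real.sq_sqrt h0]
  exact pow_le_pow_left₀ (tsum_nonneg fun k => abs_nonneg _) (hc.tsum_le_of_sum_le hfin) 2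

/-! ### Laurent series evaluated at a power-bounded unit. -/

section Evaluation

/-- Convolution of sequences on `ℤ`. -/
noncomputable def lconv (a c : ℤ → ℝ) (k : ℤ) : ℝ := ∑' j : ℤ, a j * c (k - j)

/-- Convolution powers of a sequence on `ℤ`. -/
noncomputable def lpow (a : ℤ → ℝ) : ℕ → ℤ → ℝ
  | 0 => Pi.single 0 1
  | n + 1 => lconv a (lpow a n)

/-- The coefficients of the power series `∑ w_n x^n` evaluated at the Laurent series `a`. -/
noncomputable def lseries (w : ℕ → ℝ) (a : ℤ → ℝ) (k : ℤ) : ℝ := ∑' n : ℕ, w n * lpow a n k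

/-- The shear `(j, k) ↦ (j, k - j)`. -/
def shear : ℤ × ℤ ≃ ℤ × ℤ where
  toFun z := (z.1, z.2 - z.1)
  invFun z := (z.1, z.2 + z.1)
  left_inv z := by simp
  right_inv z := by simp

theorem summable_shear {a c : ℤ → ℝ} (ha : Summable fun k => |a k|)
    (hc : Summable fun k => |c k|) : Summable fun z : ℤ × ℤ => |a z.1 * c (z.2 - z.1)| := by
  have h := ha.mul_of_nonneg hc (fun _ => abs_nonneg _) (fun _ => abs_nonneg _)
  simpa [shear, Function.comp_def, abs_mul] using shear.summable_iff.2 h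

theorem tsum_shear {a c : ℤ → ℝ} (ha : Summable fun k => |a k|) (hc : Summable fun k => |c k|) :
    ∑' z : ℤ × ℤ, |a z.1 * c (z.2 - z.1)| = (∑' k, |a k|) * ∑' k, |c k| := by
  have h := tsum_mul_tsum_of_summable_norm (f := fun k => |a k|) (g := fun k => |c k|)
    (by simpa using ha) (by simpa using hc)
  rw [h, ← shear.tsum_eq (fun z : ℤ × ℤ => |a z.1| * |c z.2|)]
  simp [shear, abs_mul]

theorem summable_lconv {a c : ℤ → ℝ} (ha : Summable fun k => |a k|)
    (hc : Summable fun k => |c k|) : Summable fun k => |lconv a c k| := by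
  have h := (summable_shear ha hc).prod_symm
  refine Summable.of_nonneg_of_le (fun _ => abs_nonneg _) (fun k => ?_) h.prod
  have := norm_tsum_le_tsum_norm (f := fun j => a j * c (k - j)) (h.prod_factor k)
  simpa [lconv] using this

theorem tsum_lconv_le {a c : ℤ → ℝ} (ha : Summable fun k => |a k|)
    (hc : Summable fun k => |c k|) :
    ∑' k, |lconv a c k| ≤ (∑' k, |a k|) * ∑' k, |c k| := by
  have h := (summable_shear ha hc).prod_symm
  rw [← tsum_shear ha hc, ← (Equiv.prodComm ℤ ℤ).tsum_eq]
  refine le_trans ?_ h.tsum_prod.ge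
  refine (summable_lconv ha hc).tsum_le_tsum (fun k => ?_) h.prod
  have := norm_tsum_le_tsum_norm (f := fun j => a j * c (k - j)) (h.prod_factor k)
  simpa [lconv] using this

theorem lpow_summable {a : ℤ → ℝ} (ha : Summable fun k => |a k|) (n : ℕ) :
    Summable fun k => |lpow a n k| := by
  induction n with
  | zero => exact (hasSum_pi_single (0 : ℤ) (1 : ℝ)).summable.abs
  | succ n ih => exact summable_lconv ha ih

theorem tsum_lpow_le {a : ℤ → ℝ} (ha : Summable fun k => |a k|) (h1 : ∑' k, |a k| ≤ 1) (n : ℕ) :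
    ∑' k, |lpow a n k| ≤ 1 := by
  induction n with
  | zero =>
    have : ∀ k : ℤ, |lpow a 0 k| = (Pi.single 0 1 : ℤ → ℝ) k := by
      intro k; by_cases hk : k = 0
      · subst hk; simp [lpow]
      · simp [lpow, hk]
    simp [this]
  | succ n ih =>
    exact (tsum_lconv_le ha (lpow_summable ha n)).trans
      (mul_le_one₀ h1 (tsum_nonneg fun _ => abs_nonneg _) ih)

theorem summable_lseries_prod {w : ℕ → ℝ} {a : ℤ → ℝ} (hw : Summable fun n => |w n|)
    (ha : Summable fun k => |a k|) (h1 : ∑' k, |a k| ≤ 1) :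
    Summable fun z : ℕ × ℤ => |w z.1 * lpow a z.1 z.2| := by
  rw [summable_prod_of_nonneg (fun _ => abs_nonneg _)]
  refine ⟨fun n => by simpa [abs_mul] using (lpow_summable ha n).mul_left |w n|, ?_⟩
  refine Summable.of_nonneg_of_le (fun n => tsum_nonneg fun _ => abs_nonneg _) (fun n => ?_) hw
  simp only [abs_mul, tsum_mul_left]
  exact mul_le_of_le_one_right (abs_nonneg _) (tsum_lpow_le ha h1 n)

theorem summable_lseries {w : ℕ → ℝ} {a : ℤ → ℝ} (hw : Summable fun n => |w n|)
    (ha : Summable fun k => |a k|) (h1 : ∑' k, |a k| ≤ 1) :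
    Summable fun k => |lseries w a k| := by
  have h := (summable_lseries_prod hw ha h1).prod_symm
  refine Summable.of_nonneg_of_le (fun _ => abs_nonneg _) (fun k => ?_) h.prod
  have := norm_tsum_le_tsum_norm (f := fun n => w n * lpow a n k) (h.prod_factor k)
  simpa [lseries] using this

variable {B : Type*} [NormedRing B] [NormedAlgebra ℝ B]

/-- Evaluation of the Laurent series with coefficients `c` at the unit `v`. -/
noncomputable def ev (v : Bˣ) (c : ℤ → ℝ) : B := ∑' k : ℤ, c k • ((v ^ k : Bˣ) : B)

variable {v : Bˣ}

theorem norm_ev_term_le (hv : ∀ k : ℤ, ‖((v ^ k : Bˣ) : B)‖ ≤ 1) (r : ℝ) (k : ℤ) :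
    ‖r • ((v ^ k : Bˣ) : B)‖ ≤ |r| := by
  rw [norm_smul, Real.norm_eq_abs]
  exact mul_le_of_le_one_right (abs_nonneg _) (hv k)

theorem norm_ev_le (hv : ∀ k : ℤ, ‖((v ^ k : Bˣ) : B)‖ ≤ 1) {c : ℤ → ℝ}
    (hc : Summable fun k => |c k|) : ‖ev v c‖ ≤ ∑' k, |c k| :=
  tsum_of_norm_bounded hc.hasSum fun _ => norm_ev_term_le hv _ _

variable [CompleteSpace B]

theorem hasSum_ev (hv : ∀ k : ℤ, ‖((v ^ k : Bˣ) : B)‖ ≤ 1) {c : ℤ → ℝ}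
    (hc : Summable fun k => |c k|) :
    HasSum (fun k : ℤ => c k • ((v ^ k : Bˣ) : B)) (ev v c) :=
  (Summable.of_norm_bounded hc fun _ => norm_ev_term_le hv _ _).hasSum

theorem ev_lconv (hv : ∀ k : ℤ, ‖((v ^ k : Bˣ) : B)‖ ≤ 1) {a c : ℤ → ℝ}
    (ha : Summable fun k => |a k|) (hc : Summable fun k => |c k|) :
    ev v (lconv a c) = ev v a * ev v c := by
  have hna : Summable fun k : ℤ => ‖a k • ((v ^ k : Bˣ) : B)‖ :=
    Summable.of_nonneg_of_le (fun _ => norm_nonneg _) (fun _ => norm_ev_term_le hv _ _) ha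
  have hnc : Summable fun k : ℤ => ‖c k • ((v ^ k : Bˣ) : B)‖ :=
    Summable.of_nonneg_of_le (fun _ => norm_nonneg _) (fun _ => norm_ev_term_le hv _ _) hc
  have hG : Summable fun z : ℤ × ℤ => (a z.2 * c (z.1 - z.2)) • ((v ^ z.1 : Bˣ) : B) :=
    Summable.of_norm_bounded (summable_shear ha hc).prod_symm fun z => norm_ev_term_le hv _ _
  rw [ev, ev, ev, tsum_mul_tsum_of_summable_norm hna hnc, ← shear.tsum_eq,
    ← (Equiv.prodComm ℤ ℤ).tsum_eq]
  have e : ∀ z : ℤ × ℤ, a (shear ((Equiv.prodComm ℤ ℤ) z)).1 •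
      ((v ^ (shear ((Equiv.prodComm ℤ ℤ) z)).1 : Bˣ) : B) *
      c (shear ((Equiv.prodComm ℤ ℤ) z)).2 •
      ((v ^ (shear ((Equiv.prodComm ℤ ℤ) z)).2 : Bˣ) : B) =
      (a z.2 * c (z.1 - z.2)) • ((v ^ z.1 : Bˣ) : B) := by
    intro z
    simp only [shear, Equiv.prodComm_apply, Equiv.coe_fn_mk, Prod.fst_swap, Prod.snd_swap]
    rw [smul_mul_smul_comm, ← Units.val_mul, ← zpow_add, add_sub_cancel]
  simp only [e]
  rw [Summable.tsum_prod hG]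
  refine tsum_congr fun k => ?_
  have hk : Summable fun j => a j * c (k - j) :=
    Summable.of_abs ((summable_shear ha hc).prod_symm.prod_factor k)
  exact hk.tsum_smul_const _ |>.symm

theorem ev_lpow (hv : ∀ k : ℤ, ‖((v ^ k : Bˣ) : B)‖ ≤ 1) {a : ℤ → ℝ}
    (ha : Summable fun k => |a k|) (n : ℕ) :
    ev v (lpow a n) = ev v a ^ n := by
  induction n with
  | zero =>
    rw [ev, tsum_eq_single 0 (fun k hk => by simp [lpow, hk])]
    simp [lpow]
  | succ n ih => rw [lpow, ev_lconv hv ha (lpow_summable ha n), ih, pow_succ']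

/-- One coefficient sequence `lseries w a` serves every unit `v`. Evaluated at `exp(it)` it yields a
function of `φ(t)`; evaluated at a translation it yields the operator to be estimated. -/
theorem hasSum_ev_lseries (hv : ∀ k : ℤ, ‖((v ^ k : Bˣ) : B)‖ ≤ 1) {w : ℕ → ℝ} {a : ℤ → ℝ}
    (hw : Summable fun n => |w n|)
    (ha : Summable fun k => |a k|) (h1 : ∑' k, |a k| ≤ 1) :
    HasSum (fun n => w n • ev v a ^ n) (ev v (lseries w a)) := by
  have hG : Summable fun z : ℕ × ℤ => (w z.1 * lpow a z.1 z.2) • ((v ^ z.2 : Bˣ) : B) :=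
    Summable.of_norm_bounded (summable_lseries_prod hw ha h1) fun z => norm_ev_term_le hv _ _
  have h2 := hG.hasSum.prod_fiberwise fun n =>
    (hG.prod_factor n).hasSum
  have e : ∀ n, ∑' k : ℤ, (w n * lpow a n k) • ((v ^ k : Bˣ) : B) = w n • ev v a ^ n := by
    intro n
    rw [← ev_lpow hv ha, ev]
    simp only [mul_smul]
    exact (hasSum_ev hv (lpow_summable ha n)).summable.tsum_const_smul _
  simp only [e] at h2
  convert h2 using 1
  rw [← (Equiv.prodComm ℤ ℕ).tsum_eq]
  refine Eq.trans ?_ ((Equiv.prodComm ℤ ℕ).summable_iff.2 hG).tsum_prod.symm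
  refine tsum_congr fun k => ?_
  have hk : Summable fun n => w n * lpow a n k :=
    Summable.of_abs ((summable_lseries_prod hw ha h1).prod_symm.prod_factor k)
  exact hk.tsum_smul_const _ |>.symm

end Evaluation

/-! ### The exponential in a commutative Banach algebra. -/

section Exponential

set_option linter.unusedSectionVars false

variable {B : Type*} [NormedCommRing B] [NormedAlgebra ℝ B] [CompleteSpace B]

theorem hasSum_of_eq {ι M : Type*} [AddCommMonoid M] [TopologicalSpace M] {f g : ι → M} {s : M}
    (hfg : ∀ i, f i = g i) (hg : HasSum g s) : HasSum f s := by
  rwa [funext hfg]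

theorem exp_add_real (x y : B) :
    NormedSpace.exp (x + y) = NormedSpace.exp x * NormedSpace.exp y := by
  let _ := NormedAlgebra.restrictScalars ℚ ℝ B
  exact NormedSpace.exp_add

theorem hasSum_exp_real (x : B) :
    HasSum (fun n : ℕ => (n ! : ℝ)⁻¹ • x ^ n) (NormedSpace.exp x) :=
  NormedSpace.exp_series_hasSum_exp' x

theorem exp_smul_one (r : ℝ) : NormedSpace.exp (r • (1 : B)) = Real.exp r • (1 : B) := by
  rw [← Algebra.algebraMap_eq_smul_one, ← Algebra.algebraMap_eq_smul_one, Real.exp_eq_exp_ℝ,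
    NormedSpace.algebraMap_exp_comm]

theorem exp_nsmul_real (n : ℕ) (x : B) : NormedSpace.exp ((n : ℝ) • x) = NormedSpace.exp x ^ n := by
  induction n with
  | zero => simp
  | succ n ih => rw [pow_succ, ← ih, ← exp_add_real, Nat.cast_succ, add_smul, one_smul]

theorem norm_exp_le_real [NormOneClass B] (x : B) : ‖NormedSpace.exp x‖ ≤ Real.exp ‖x‖ := by
  have h := hasSum_exp_real x
  have h2 := hasSum_exp_real (B := ℝ) ‖x‖
  rw [← Real.exp_eq_exp_ℝ] at h2
  rw [← h.tsum_eq]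
  refine tsum_of_norm_bounded h2 fun n => ?_
  rw [norm_smul, smul_eq_mul, norm_inv, Real.norm_natCast]
  gcongr
  exact norm_pow_le _ _

/-- `exp{t(X - r)}` is a contraction when `‖X‖ ≤ r`. -/
theorem norm_exp_smul_sub_le_one [NormOneClass B] {x : B} {r t : ℝ} (hx : ‖x‖ ≤ r) (ht : 0 ≤ t) :
    ‖NormedSpace.exp (t • (x - r • 1))‖ ≤ 1 := by
  have e : t • (x - r • 1) = t • x + (-(t * r)) • (1 : B) := by
    rw [smul_sub, smul_smul, neg_smul, sub_eq_add_neg]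
  rw [e, exp_add_real, exp_smul_one, mul_smul_comm, mul_one, norm_smul, Real.norm_eq_abs,
    Real.abs_exp]
  calc _ ≤ Real.exp (-(t * r)) * Real.exp ‖t • x‖ := by
        gcongr; exact norm_exp_le_real _
    _ ≤ 1 := by
        rw [← Real.exp_add, Real.exp_le_one_iff, norm_smul, Real.norm_eq_abs, abs_of_nonneg ht]
        nlinarith

/-- The power series coefficients of `(x - 1) exp{t(x - 1)}`. -/
noncomputable def expDiffCoeff (t : ℝ) (n : ℕ) : ℝ :=
  Real.exp (-t) * ((n : ℝ) * t ^ (n - 1) / (n !) - t ^ n / n !)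

/-- For `n ≥ 1` the coefficient is `t^(n-1)/(n-1)!`. At `n = 0` the factor `n` makes it vanish, so
the truncated subtraction `n - 1` is harmless. -/
theorem hasSum_shift_exp (t : ℝ) (x : B) :
    HasSum (fun n : ℕ => ((n : ℝ) * t ^ (n - 1) / n !) • x ^ n) (x * NormedSpace.exp (t • x)) := by
  rw [← hasSum_nat_add_iff' 1]
  simp only [Finset.range_one, Finset.sum_singleton, Nat.cast_zero, zero_mul, zero_div, zero_smul,
    sub_zero]
  refine hasSum_of_eq (fun n => ?_) ((hasSum_exp_real (t • x)).mul_left x)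
  rw [Nat.factorial_succ, smul_pow, smul_smul, mul_smul_comm, ← pow_succ']
  congr 1
  push_cast
  have : (n ! : ℝ) ≠ 0 := by positivity
  field_simp

theorem hasSum_expDiffCoeff (t : ℝ) (x : B) :
    HasSum (fun n => expDiffCoeff t n • x ^ n) ((x - 1) * NormedSpace.exp (t • (x - 1))) := by
  have e : t • (x - 1) = t • x + (-t) • (1 : B) := by
    rw [smul_sub, neg_smul, sub_eq_add_neg]
  rw [e, exp_add_real, exp_smul_one]
  have h := ((hasSum_shift_exp t x).sub (hasSum_exp_real (t • x))).const_smul (Real.exp (-t))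
  have e2 : (x - 1) * (NormedSpace.exp (t • x) * Real.exp (-t) • 1) =
      Real.exp (-t) • (x * NormedSpace.exp (t • x) - NormedSpace.exp (t • x)) := by
    rw [mul_smul_comm, mul_smul_comm, mul_one, sub_mul, one_mul]
  rw [e2]
  refine hasSum_of_eq (fun n => ?_) h
  · rw [expDiffCoeff, mul_smul, sub_smul, smul_pow, smul_smul _ (t ^ n), div_eq_inv_mul (t ^ n)]

theorem summable_expDiffCoeff (t : ℝ) : Summable fun n => |expDiffCoeff t n| := by
  have h1 := (hasSum_shift_exp (B := ℝ) |t| 1).summable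
  have h2 := (hasSum_exp_real (B := ℝ) |t|).summable
  refine Summable.of_nonneg_of_le (fun _ => abs_nonneg _) (fun n => ?_)
    ((h1.add h2).mul_left (Real.exp (-t)))
  rw [expDiffCoeff, abs_mul, Real.abs_exp]
  gcongr
  refine (abs_sub _ _).trans (le_of_eq ?_)
  simp [abs_mul, abs_pow, div_eq_inv_mul]

end Exponential

/-! ### Scalar inequalities and smoothing in one direction. -/

/-- The unit `exp(it)` of `ℂ`. -/
noncomputable def circleUnit (t : ℝ) : ℂˣ := Units.mk0 (Complex.exp (t * Complex.I))
  (Complex.exp_ne_zero _)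

theorem circleUnit_zpow (t : ℝ) (k : ℤ) :
    ((circleUnit t ^ k : ℂˣ) : ℂ) = Complex.exp (k * t * Complex.I) := by
  rw [Units.val_zpow_eq_zpow_val, circleUnit, Units.val_mk0, ← Complex.exp_int_mul]
  congr 1; ring

theorem norm_circleUnit_zpow (t : ℝ) (k : ℤ) : ‖((circleUnit t ^ k : ℂˣ) : ℂ)‖ ≤ 1 := by
  rw [circleUnit_zpow]
  have := Complex.norm_exp_ofReal_mul_I (k * t)
  push_cast at this
  exact this.le

/-- On `[0, 1]` the left side peaks at `y = 1/3` with value `4/27 < 3/20`. Beyond `1`, tangent lines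
of the exponential touching at `y = 14/5` and `y - 1 = 7/4` are used: both points are close to the
maximiser `y ≈ 2.76` of the ratio, and the slopes add up to `5/14 + 2 · 4/7 = 3/2`. -/
theorem ratio_neg_one_le_exp {y : ℝ} (hy : 0 ≤ y) :
    y * (1 - y) ^ 2 ≤ 3 / 20 * Real.exp (3 / 2 * y) := by
  rcases le_total y 1 with h | h
  · have h1 : y * (1 - y) ^ 2 ≤ 3 / 20 := by
      nlinarith [mul_nonneg hy (sq_nonneg (y - 1 / 3)), sq_nonneg (y - 1 / 3),
        mul_nonneg (sub_nonneg.2 h) (sq_nonneg (y - 1 / 3))]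
    have h2 : 1 ≤ Real.exp (3 / 2 * y) := Real.one_le_exp (by positivity)
    linarith
  · have e1 : y ≤ 14 / 5 * Real.exp (5 / 14 * y - 1) := by
      have := Real.add_one_le_exp (5 / 14 * y - 1)
      linarith
    have e2 : y - 1 ≤ 7 / 4 * Real.exp (4 / 7 * (y - 1) - 1) := by
      have := Real.add_one_le_exp (4 / 7 * (y - 1) - 1)
      linarith
    have e3 : y * (1 - y) ^ 2 ≤
        14 / 5 * Real.exp (5 / 14 * y - 1) * (7 / 4 * Real.exp (4 / 7 * (y - 1) - 1)) ^ 2 := by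
      have : (1 - y) ^ 2 = (y - 1) ^ 2 := by ring
      rw [this]
      gcongr
    have e4 : Real.exp (5 / 14 * y - 1) * Real.exp (4 / 7 * (y - 1) - 1) ^ 2 =
        Real.exp (-(29 / 7)) * Real.exp (3 / 2 * y) := by
      rw [← Real.exp_nat_mul, ← Real.exp_add, ← Real.exp_add]
      congr 1; push_cast; ring
    have e5 : Real.exp (-(29 / 7)) ≤ 0.0174 := by
      have h7 : Real.exp (-(29 / 7)) ≤ Real.exp (-1) ^ 4 * (7 / 8) := by
        rw [← Real.exp_nat_mul]
        have : Real.exp (-(1 / 7)) ≤ 7 / 8 := by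
          rw [Real.exp_neg]
          have := Real.add_one_le_exp (1 / 7 : ℝ)
          rw [inv_le_comm₀ (Real.exp_pos _) (by norm_num)]
          norm_num at this ⊢
          exact this
        calc Real.exp (-(29 / 7)) = Real.exp ((4 : ℕ) * (-1 : ℝ)) * Real.exp (-(1 / 7)) := by
              rw [← Real.exp_add]; norm_num
          _ ≤ _ := by gcongr
      have := Real.exp_neg_one_lt_d9
      calc _ ≤ (0.3678794412 : ℝ) ^ 4 * (7 / 8) := by
            refine h7.trans ?_
            gcongr
        _ ≤ _ := by norm_num
    calc _ ≤ _ := e3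
      _ = 14 / 5 * (7 / 4) ^ 2 *
          (Real.exp (5 / 14 * y - 1) * Real.exp (4 / 7 * (y - 1) - 1) ^ 2) := by ring
      _ = 14 / 5 * (7 / 4) ^ 2 * Real.exp (-(29 / 7)) * Real.exp (3 / 2 * y) := by rw [e4]; ring
      _ ≤ _ := by
          gcongr
          linarith

/-- The maximum of `y² exp(-3y/2)` is `(4/3)² e⁻² ≈ 0.2406`, attained at `y = 4/3`. -/
theorem sq_le_exp {y : ℝ} (hy : 0 ≤ y) : y ^ 2 ≤ 0.241 * Real.exp (3 / 2 * y) := by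
  have h1 : 3 / 4 * y ≤ Real.exp (3 / 4 * y - 1) := by
    have := Real.add_one_le_exp (3 / 4 * y - 1); linarith
  have h2 : (3 / 4 * y) ^ 2 ≤ Real.exp (3 / 4 * y - 1) ^ 2 := by gcongr
  have h3 : Real.exp (3 / 4 * y - 1) ^ 2 = Real.exp (-1) ^ 2 * Real.exp (3 / 2 * y) := by
    rw [← Real.exp_nat_mul, ← Real.exp_nat_mul, ← Real.exp_add]
    congr 1; push_cast; ring
  have h4 : Real.exp (-1) ^ 2 ≤ (0.3678794412 : ℝ) ^ 2 := by
    have := Real.exp_neg_one_lt_d9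
    gcongr
  have h5 := Real.exp_pos (3 / 2 * y)
  nlinarith

theorem cube_le_exp {y : ℝ} (hy : 0 ≤ y) : y * (1 + y) ^ 2 ≤ 216 * Real.exp (y / 2) := by
  have h1 : 1 + y ≤ 6 * Real.exp (y / 6) := by
    have := Real.add_one_le_exp (y / 6); linarith
  have h2 : (1 + y) ^ 3 ≤ (6 * Real.exp (y / 6)) ^ 3 := by gcongr
  have h3 : Real.exp (y / 6) ^ 3 = Real.exp (y / 2) := by
    rw [← Real.exp_nat_mul]; congr 1; push_cast; ring
  rw [mul_pow, h3] at h2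
  have h4 : y * (1 + y) ^ 2 ≤ (1 + y) ^ 3 := by nlinarith [sq_nonneg (1 + y)]
  linarith

/-- Here `z` stands for `1 - φ` and `1 - p z` for the characteristic function of the lazy step. The
factor `1 - p` pays for values of `φ` near `-1`: the lower side amounts to `p(2 - p)z ≤ 2`, which at
`z = 2` is `(1 - p)² ≥ 0`. -/
theorem abs_one_sub_mul_le_exp {p z : ℝ} (hp : 0 ≤ p) (hp1 : p ≤ 1) (hz : 0 ≤ z) (hz2 : z ≤ 2) :
    |1 - p * z| ≤ Real.exp (-((1 - p) * (p * z))) := by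
  have h1 := Real.add_one_le_exp (-((1 - p) * (p * z)))
  have hpz : 0 ≤ p * z := by positivity
  rw [abs_le]
  constructor
  · have : -1 ≤ 1 - p * z - ((1 - p) * (p * z)) := by
      nlinarith [sq_nonneg (p - 1), mul_nonneg hp (sub_nonneg.2 hz2),
        mul_nonneg (mul_nonneg hp (sub_nonneg.2 hp1)) (sub_nonneg.2 hz2)]
    linarith
  · nlinarith

theorem sqrt_pi_le : √Real.pi ≤ 1.773 := by
  rw [Real.sqrt_le_left (by norm_num)]
  have := Real.pi_lt_d4
  norm_num at this ⊢
  linarith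

namespace IsStep

variable {a : ℤ → ℝ}

theorem summable_abs_coeff (ha : IsStep a) : Summable fun k => |a k| := ha.hasSum.summable.abs

theorem tsum_abs_coeff (ha : IsStep a) : ∑' k, |a k| = 1 := by
  simp_rw [abs_of_nonneg (ha.nonneg _)]
  exact ha.hasSum.tsum_eq

theorem ev_circleUnit (ha : IsStep a) (t : ℝ) : ev (circleUnit t) a = (cosSum a t : ℂ) := by
  have h1 := hasSum_ev (norm_circleUnit_zpow t) ha.summable_abs_coeff
  have h2 := (Equiv.neg ℤ).hasSum_iff.2 h1
  have h3 := (h1.add h2).mul_left (1 / 2 : ℂ)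
  have h4 : HasSum (fun k : ℤ => ((a k * Real.cos (k * t) : ℝ) : ℂ)) (cosSum a t : ℂ) :=
    Complex.hasSum_ofReal.2 (ha.summable_cos t).hasSum
  have h5 := h3.unique (hasSum_of_eq (fun k => ?_) h4)
  · rw [← h5]; ring
  · simp only [Function.comp_apply, Equiv.neg_apply, ha.symm, circleUnit_zpow]
    push_cast
    rw [Complex.cos, Complex.real_smul, Complex.real_smul]
    have e : -(k : ℂ) * t * Complex.I = -(k * t) * Complex.I := by ring
    rw [e]
    ring

variable {A : Type*} [NormedCommRing A] [NormedAlgebra ℝ A] {u : Aˣ}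

theorem norm_ev_le_one (ha : IsStep a) (hu : ∀ k : ℤ, ‖((u ^ k : Aˣ) : A)‖ ≤ 1) : ‖ev u a‖ ≤ 1 :=
  (norm_ev_le hu ha.summable_abs_coeff).trans ha.tsum_abs_coeff.le

variable [CompleteSpace A]

/-- A power series in the operator `ev u a` is controlled by the values of the same series at the
characteristic function of `a`. -/
theorem sq_norm_le (ha : IsStep a) (hu : ∀ k : ℤ, ‖((u ^ k : Aˣ) : A)‖ ≤ 1) {w : ℕ → ℝ}
    (hw : Summable fun n => |w n|) {x : A}
    (hx : HasSum (fun n => w n • ev u a ^ n) x) {h h' : ℝ → ℝ}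
    (hh : ∀ t, HasSum (fun n => w n * cosSum a t ^ n) (h t))
    (hd : ∀ t, HasDerivAt h (h' t) t) (hcont : Continuous h') {C D b l : ℝ} (hb : 0 < b)
    (hl : 0 < l) (hC : ∀ t, h t ^ 2 ≤ C * Real.exp (-l * (1 - cosSum a t)))
    (hD : ∀ t, h' t ^ 2 ≤ D * Real.exp (-l * (1 - cosSum a t))) :
    ‖x‖ ^ 2 ≤ (1 + Real.pi * b) * ((C + D / b ^ 2) * (√(Real.pi / (2 * l)) / 2)) := by
  have hs := ha.summable_abs_coeff
  have h1 := ha.tsum_abs_coeff.le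
  have hc := summable_lseries hw hs h1
  have hxe : x = ev u (lseries w a) := hx.unique (hasSum_ev_lseries hu hw hs h1)
  refine le_trans ?_ (ha.sq_tsum_abs_le hc (fun t => ?_) hd hcont hb hl hC hD)
  · rw [hxe]
    gcongr
    exact norm_ev_le hu hc
  · have e1 := hasSum_ev (norm_circleUnit_zpow t) hc
    have e2 := hasSum_ev_lseries (norm_circleUnit_zpow t) hw hs h1
    rw [ha.ev_circleUnit] at e2
    have e3 : HasSum (fun n => w n • (cosSum a t : ℂ) ^ n) (h t : ℂ) := by
      refine hasSum_of_eq (fun n => ?_) (Complex.hasSum_ofReal.2 (hh t))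
      rw [Complex.real_smul]; push_cast; rfl
    rw [e3.unique e2]
    refine hasSum_of_eq (fun k => ?_) e1
    rw [circleUnit_zpow, Complex.real_smul]

variable [NormOneClass A]

theorem norm_diff_mul_exp_le_two (ha : IsStep a) (hu : ∀ k : ℤ, ‖((u ^ k : Aˣ) : A)‖ ≤ 1) {t : ℝ}
    (ht : 0 ≤ t) :
    ‖(ev u a - 1) * NormedSpace.exp (t • (ev u a - 1))‖ ≤ 2 := by
  have h1 := ha.norm_ev_le_one hu
  have h2 : ‖NormedSpace.exp (t • (ev u a - (1 : ℝ) • 1))‖ ≤ 1 := norm_exp_smul_sub_le_one h1 ht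
  rw [one_smul] at h2
  calc _ ≤ ‖ev u a - 1‖ * ‖NormedSpace.exp (t • (ev u a - 1))‖ := norm_mul_le _ _
    _ ≤ (1 + 1) * 1 := by
        gcongr
        refine (norm_sub_le _ _).trans ?_
        rw [norm_one]; gcongr
    _ = 2 := by norm_num

/-- Smoothing by the symmetric compound Poisson law, with the sharp constant. -/
theorem sq_norm_diff_mul_exp_le (ha : IsStep a) (hu : ∀ k : ℤ, ‖((u ^ k : Aˣ) : A)‖ ≤ 1) {t : ℝ}
    (ht : 0 < t) :
    (‖(ev u a - 1) * NormedSpace.exp (t • (ev u a - 1))‖ * t) ^ 2 ≤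
      1.76 * (1 + stepSigma a) := by
  have hs := ha.one_le_sigma
  -- For small `t` the trivial bound `2` suffices, since `1.8² = 3.24 ≤ 1.76 · 2` and `σ ≥ 1`.
  rcases le_total t (9 / 10) with hle | hge
  · have := ha.norm_diff_mul_exp_le_two hu ht.le
    calc _ ≤ ((2 : ℝ) * (9 / 10)) ^ 2 := by gcongr
      _ = 3.24 := by norm_num
      _ ≤ 1.76 * (1 + stepSigma a) := by linarith
  · set s := stepSigma a
    -- Of the decay `exp(-2tz)`, with `z = 1 - φ`, the part `exp(-3tz/2)` absorbs the polynomial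
    -- factors and `exp(-tz/2)` is left to integrate, hence `l = t/2`. The scale `b = s√t` is the
    -- standard deviation at time `t`; it makes `D/b²` equal to `0.3/t²`, and `0.241 + 0.3 = 0.541`.
    have key := ha.sq_norm_le hu (summable_expDiffCoeff t) (hasSum_expDiffCoeff t (ev u a))
      (h := fun θ => (cosSum a θ - 1) * Real.exp (t * (cosSum a θ - 1)))
      (h' := fun θ => cosSumDeriv a θ * (1 + t * (cosSum a θ - 1)) *
        Real.exp (t * (cosSum a θ - 1)))
      (C := 0.241 / t ^ 2) (D := 3 / 10 * s ^ 2 / t) (b := s * √t) (l := t / 2)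
      (fun θ => ?_) (fun θ => ?_) ?_ (by positivity) (by positivity) (fun θ => ?_) (fun θ => ?_)
    · set r := √t with hr
      have hrt : r ^ 2 = t := Real.sq_sqrt ht.le
      have hr0 : 0 < r := Real.sqrt_pos.2 ht
      have hr9 : 9 / 10 ≤ r := by
        apply Real.le_sqrt_of_sq_le; norm_num; linarith
      have e1 : √(Real.pi / (2 * (t / 2))) = √Real.pi / r := by
        rw [show 2 * (t / 2) = t by ring, Real.sqrt_div Real.pi_pos.le]
      rw [e1] at key
      have e2 : 0.241 / t ^ 2 + 3 / 10 * s ^ 2 / t / (s * r) ^ 2 = 0.541 / t ^ 2 := by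
        rw [mul_pow, hrt]
        field_simp
        norm_num
      rw [e2] at key
      rw [mul_pow]
      have hpi := Real.pi_lt_d2
      have hpi0 := Real.pi_pos
      calc _ ≤ (1 + Real.pi * (s * r)) * (0.541 / t ^ 2 * (√Real.pi / r / 2)) * t ^ 2 := by gcongr
        _ = (1 / r + Real.pi * s) * (0.541 * √Real.pi / 2) := by field_simp
        _ ≤ (10 / 9 + 3.15 * s) * (0.541 * 1.773 / 2) := by
            have h1 := sqrt_pi_le
            have h2 : 1 / r ≤ 10 / 9 := by
              rw [div_le_div_iff₀ hr0 (by norm_num)]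
              linarith
            have h3 : Real.pi * s ≤ 3.15 * s := by gcongr
            exact mul_le_mul (by linarith) (by linarith) (by positivity) (by positivity)
        _ ≤ _ := by norm_num; linarith
    · have := hasSum_expDiffCoeff t (cosSum a θ)
      rw [← Real.exp_eq_exp_ℝ] at this
      exact this
    · have h1 := (ha.hasDerivAt_cosSum θ).sub_const 1
      have h2 := h1.mul ((h1.const_mul t).exp)
      refine h2.congr_deriv ?_
      ring
    · have := ha.continuous_cosSum
      have := ha.continuous_cosSumDeriv
      fun_prop
    · have hz : 0 ≤ 1 - cosSum a θ := by linarith [ha.cosSum_le_one θ]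
      set z := 1 - cosSum a θ
      have h1 := sq_le_exp (y := t * z) (by positivity)
      have h2 : cosSum a θ - 1 = -z := by simp [z]
      simp only [h2]
      have h3 : Real.exp (t * -z) ^ 2 * Real.exp (3 / 2 * (t * z)) = Real.exp (-(t / 2) * z) := by
        rw [← Real.exp_nat_mul, ← Real.exp_add]; congr 1; push_cast; ring
      calc _ = (t * z) ^ 2 * Real.exp (t * -z) ^ 2 / t ^ 2 := by field_simp
        _ ≤ 0.241 * Real.exp (3 / 2 * (t * z)) * Real.exp (t * -z) ^ 2 / t ^ 2 := by gcongr
        _ = _ := by rw [← h3]; ring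
    · have hz : 0 ≤ 1 - cosSum a θ := by linarith [ha.cosSum_le_one θ]
      have hD := ha.cosSumDeriv_sq_le θ
      set z := 1 - cosSum a θ
      have h1 := ratio_neg_one_le_exp (y := t * z) (by positivity)
      have h2 : cosSum a θ - 1 = -z := by simp [z]
      simp only [h2]
      have h3 : Real.exp (t * -z) ^ 2 * Real.exp (3 / 2 * (t * z)) = Real.exp (-(t / 2) * z) := by
        rw [← Real.exp_nat_mul, ← Real.exp_add]; congr 1; push_cast; ring
      calc _ = cosSumDeriv a θ ^ 2 * ((1 - t * z) ^ 2 * Real.exp (t * -z) ^ 2) := by ring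
        _ ≤ 2 * s ^ 2 * z * ((1 - t * z) ^ 2 * Real.exp (t * -z) ^ 2) := by gcongr
        _ = 2 * s ^ 2 / t * (t * z * (1 - t * z) ^ 2) * Real.exp (t * -z) ^ 2 := by field_simp
        _ ≤ 2 * s ^ 2 / t * (3 / 20 * Real.exp (3 / 2 * (t * z))) * Real.exp (t * -z) ^ 2 := by
            gcongr
        _ = _ := by rw [← h3]; ring

/-- Smoothing by the powers of a lazy symmetric walk. -/
theorem sq_norm_diff_mul_pow_le (ha : IsStep a) (hu : ∀ k : ℤ, ‖((u ^ k : Aˣ) : A)‖ ≤ 1) {p : ℝ}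
    (hp : 0 < p) (hp1 : p < 1) (j : ℕ) :
    (‖(ev u a - 1) * (1 + p • (ev u a - 1)) ^ j‖ * ((j + 1) * ((1 - p) * p))) ^ 2 * (1 - p) ≤
      10 ^ 4 * (1 + stepSigma a) := by
  have hs := ha.one_le_sigma
  set s := stepSigma a
  have hx1 := ha.norm_ev_le_one hu
  have hal : 0 < 1 - p := by linarith
  have htriv : ‖(ev u a - 1) * (1 + p • (ev u a - 1)) ^ j‖ ≤ 2 := by
    have h1 : ‖ev u a - 1‖ ≤ 2 := by
      refine (norm_sub_le _ _).trans ?_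
      rw [norm_one]; linarith
    have h2 : ‖1 + p • (ev u a - 1)‖ ≤ 1 := by
      have : 1 + p • (ev u a - 1) = (1 - p) • (1 : A) + p • ev u a := by
        rw [smul_sub, sub_smul, one_smul]; abel
      rw [this]
      refine (norm_add_le _ _).trans ?_
      rw [norm_smul, norm_smul, norm_one, Real.norm_eq_abs, Real.norm_eq_abs, abs_of_pos hal,
        abs_of_pos hp]
      nlinarith
    calc _ ≤ ‖ev u a - 1‖ * ‖(1 + p • (ev u a - 1)) ^ j‖ := norm_mul_le _ _
      _ ≤ 2 * 1 := by
          gcongr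
          exact (norm_pow_le _ _).trans (pow_le_one₀ (norm_nonneg _) h2)
      _ = 2 := by norm_num
  have hpp : (1 - p) * p ≤ 1 := by nlinarith
  have hpp0 : 0 < (1 - p) * p := by positivity
  -- When `j p (1 - p) < 1` there is nothing to smooth, and the trivial bound `2` is enough.
  by_cases hl1 : (j : ℝ) * ((1 - p) * p) < 1
  · calc _ ≤ ((2 : ℝ) * 2) ^ 2 * 1 := by
          have h1 : ((j : ℝ) + 1) * ((1 - p) * p) ≤ 2 := by linarith
          have h2 : 1 - p ≤ 1 := by linarith
          gcongr
      _ ≤ _ := by norm_num; linarith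
  rw [not_lt] at hl1
  have hj : 2 ≤ j := by
    by_contra hj
    have : (j : ℝ) ≤ 1 := by exact_mod_cast (by omega : j ≤ 1)
    nlinarith [sq_nonneg (p - 1 / 2)]
  set l := (j : ℝ) * ((1 - p) * p) with hl
  have hl0 : 0 < l := by linarith
  clear_value l
  obtain ⟨i, rfl⟩ : ∃ i, j = i + 1 := ⟨j - 1, by omega⟩
  have hi : (1 : ℝ) ≤ i := by exact_mod_cast (by omega : 1 ≤ i)
  -- The power series is a polynomial here, so its coefficients are summable for free.
  let P : Polynomial ℝ := (Polynomial.X - 1) * (1 + Polynomial.C p * (Polynomial.X - 1)) ^ (i + 1)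
  have hfin : ∀ n ∉ Finset.range (P.natDegree + 1), P.coeff n = 0 := fun n hn =>
    Polynomial.coeff_eq_zero_of_natDegree_lt (by simpa using hn)
  have hw : Summable fun n => |P.coeff n| :=
    summable_of_ne_finset_zero (s := Finset.range (P.natDegree + 1)) fun n hn => by
      rw [hfin n hn, abs_zero]
  have haev : ∀ {B : Type _} [NormedCommRing B] [NormedAlgebra ℝ B] (x : B),
      HasSum (fun n => P.coeff n • x ^ n) ((x - 1) * (1 + p • (x - 1)) ^ (i + 1)) := by
    intro B _ _ x
    have h1 : (x - 1) * (1 + p • (x - 1)) ^ (i + 1) = Polynomial.aeval x P := by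
      simp [P, Algebra.smul_def]
    rw [h1, Polynomial.aeval_eq_sum_range]
    exact hasSum_sum_of_ne_finset_zero fun n hn => by rw [hfin n hn, zero_smul]
  have haevR : ∀ x : ℝ,
      HasSum (fun n => P.coeff n * x ^ n) ((x - 1) * (1 + p * (x - 1)) ^ (i + 1)) := by
    intro x
    have h1 : (x - 1) * (1 + p * (x - 1)) ^ (i + 1) = Polynomial.aeval x P := by
      simp [P]
    rw [h1, Polynomial.aeval_eq_sum_range]
    exact hasSum_sum_of_ne_finset_zero fun n hn => by rw [hfin n hn, zero_mul]
  have hgb : ∀ θ : ℝ, ∀ n : ℕ, |1 - p * (1 - cosSum a θ)| ^ n ≤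
      Real.exp (-(n * ((1 - p) * p) * (1 - cosSum a θ))) := by
    intro θ n
    have h1 := abs_one_sub_mul_le_exp hp.le hp1.le (z := 1 - cosSum a θ)
      (by linarith [ha.cosSum_le_one θ]) (by linarith [ha.neg_one_le_cosSum θ])
    calc _ ≤ _ := pow_le_pow_left₀ (abs_nonneg _) h1 n
      _ = _ := by rw [← Real.exp_nat_mul]; congr 1; ring
  -- Differentiating the power leaves only `i` factors, and `i ≥ (i + 1)/2` keeps the decay
  -- `exp(-lz/2)`. The factor `(i + 1)p = l/(1 - p)` is the source of `(1 - p)²` in `D`; the scale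
  -- `b` is enlarged by `1/(1 - p)` so that `D/b² = 432/l²`, where `432 = 2 · 216`.
  have key := ha.sq_norm_le hu hw (haev (ev u a))
    (h := fun θ => (cosSum a θ - 1) * (1 + p * (cosSum a θ - 1)) ^ (i + 1))
    (h' := fun θ => cosSumDeriv a θ * ((1 + p * (cosSum a θ - 1)) ^ (i + 1) +
      (i + 1) * p * (cosSum a θ - 1) * (1 + p * (cosSum a θ - 1)) ^ i))
    (C := 1 / l ^ 2) (D := 432 * s ^ 2 / (l * (1 - p) ^ 2)) (b := s * √l / (1 - p)) (l := l / 2)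
    (fun θ => haevR _) (fun θ => ?_) ?_ (by positivity) (by positivity) (fun θ => ?_) (fun θ => ?_)
  · set r := √l with hr
    have hrl : r ^ 2 = l := Real.sq_sqrt hl0.le
    have hr0 : 0 < r := Real.sqrt_pos.2 hl0
    have hr1 : 1 ≤ r := by
      apply Real.le_sqrt_of_sq_le; linarith
    have e1 : √(Real.pi / (2 * (l / 2))) = √Real.pi / r := by
      rw [show 2 * (l / 2) = l by ring, Real.sqrt_div Real.pi_pos.le]
    rw [e1] at key
    have e2 : 1 / l ^ 2 + 432 * s ^ 2 / (l * (1 - p) ^ 2) / (s * r / (1 - p)) ^ 2 =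
        433 / l ^ 2 := by
      rw [div_pow, mul_pow, hrl]
      field_simp
      norm_num
    rw [e2] at key
    have hpi := Real.pi_le_four
    have hpi0 := Real.pi_pos
    have hfac : (((i + 1 : ℕ) : ℝ) + 1) * ((1 - p) * p) ≤ 2 * l := by
      rw [hl]
      have : ((i + 1 : ℕ) : ℝ) + 1 ≤ 2 * ((i + 1 : ℕ) : ℝ) := by push_cast; linarith
      nlinarith
    calc _ ≤ (‖(ev u a - 1) * (1 + p • (ev u a - 1)) ^ (i + 1)‖ * (2 * l)) ^ 2 * (1 - p) := by
          gcongr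
      _ = ‖(ev u a - 1) * (1 + p • (ev u a - 1)) ^ (i + 1)‖ ^ 2 * (4 * l ^ 2 * (1 - p)) := by ring
      _ ≤ (1 + Real.pi * (s * r / (1 - p))) * (433 / l ^ 2 * (√Real.pi / r / 2)) *
          (4 * l ^ 2 * (1 - p)) := by gcongr
      _ = ((1 - p) / r + Real.pi * s) * (433 * √Real.pi / 2 * 4) := by
          field_simp
      _ ≤ (1 + 4 * s) * (433 * 2 / 2 * 4) := by
          have := sqrt_pi_le
          gcongr
          · rw [div_le_one hr0]; linarith
          · linarith
      _ ≤ _ := by norm_num; linarith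
  · have h1 := (ha.hasDerivAt_cosSum θ).sub_const 1
    have h2 := h1.mul (((h1.const_mul p).const_add 1).pow (i + 1))
    refine h2.congr_deriv ?_
    simp only [Nat.add_sub_cancel, Pi.pow_apply]
    push_cast
    ring
  · have := ha.continuous_cosSum
    have := ha.continuous_cosSumDeriv
    fun_prop
  · have hz : 0 ≤ 1 - cosSum a θ := by linarith [ha.cosSum_le_one θ]
    have hg := hgb θ (i + 1)
    set z := 1 - cosSum a θ
    have h1 := sq_le_exp (y := l * z) (by positivity)
    have h2 : cosSum a θ - 1 = -z := by simp [z]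
    have h3 : 1 + p * -z = 1 - p * z := by ring
    simp only [h2, h3]
    rw [← hl] at hg
    have h4 : Real.exp (-(l * z)) ^ 2 * Real.exp (3 / 2 * (l * z)) = Real.exp (-(l / 2) * z) := by
      rw [← Real.exp_nat_mul, ← Real.exp_add]; congr 1; push_cast; ring
    calc _ = (l * z) ^ 2 * (|1 - p * z| ^ (i + 1)) ^ 2 / l ^ 2 := by
          rw [← abs_pow, sq_abs]; field_simp
      _ ≤ (1 * Real.exp (3 / 2 * (l * z))) * Real.exp (-(l * z)) ^ 2 / l ^ 2 := by
          gcongr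
          refine h1.trans ?_
          gcongr
          norm_num
      _ = _ := by rw [← h4]; ring
  · have hz : 0 ≤ 1 - cosSum a θ := by linarith [ha.cosSum_le_one θ]
    have hg := hgb θ (i + 1)
    have hg' := hgb θ i
    have hD := ha.cosSumDeriv_sq_le θ
    set z := 1 - cosSum a θ
    have h1 := cube_le_exp (y := l * z) (by positivity)
    have h2 : cosSum a θ - 1 = -z := by simp [z]
    have h3 : 1 + p * -z = 1 - p * z := by ring
    simp only [h2, h3]
    rw [← hl] at hg
    have hhalf : l / 2 ≤ i * ((1 - p) * p) := by
      rw [hl]; push_cast; nlinarith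
    have h5 : |1 - p * z| ^ (i + 1) ≤ Real.exp (-(l / 2 * z)) / (1 - p) := by
      rw [le_div_iff₀ hal]
      calc _ ≤ Real.exp (-(l * z)) * 1 := by gcongr; linarith
        _ ≤ _ := by
          rw [mul_one]; apply Real.exp_le_exp.2; nlinarith
    have h6 : |1 - p * z| ^ i ≤ Real.exp (-(l / 2 * z)) := by
      refine hg'.trans (Real.exp_le_exp.2 ?_)
      nlinarith
    have h7 : ((i : ℝ) + 1) * p = l / (1 - p) := by
      rw [hl]; push_cast; field_simp
    have h8 : |(1 - p * z) ^ (i + 1) + (i + 1) * p * -z * (1 - p * z) ^ i| ≤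
        (1 + l * z) / (1 - p) * Real.exp (-(l / 2 * z)) := by
      rw [h7]
      refine (abs_add_le _ _).trans ?_
      rw [abs_mul, abs_mul, abs_neg, abs_pow, abs_pow, abs_of_nonneg hz,
        abs_of_nonneg (by positivity : 0 ≤ l / (1 - p))]
      calc _ ≤ Real.exp (-(l / 2 * z)) / (1 - p) + l / (1 - p) * z * Real.exp (-(l / 2 * z)) := by
            gcongr
        _ = _ := by ring
    have h9 : Real.exp (-(l / 2 * z)) ^ 2 * Real.exp (l * z / 2) = Real.exp (-(l / 2) * z) := by
      rw [← Real.exp_nat_mul, ← Real.exp_add]; congr 1; push_cast; ring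
    calc _ = cosSumDeriv a θ ^ 2 *
          |(1 - p * z) ^ (i + 1) + (i + 1) * p * -z * (1 - p * z) ^ i| ^ 2 := by
          rw [sq_abs, mul_pow]
      _ ≤ 2 * s ^ 2 * z * ((1 + l * z) / (1 - p) * Real.exp (-(l / 2 * z))) ^ 2 := by gcongr
      _ = 2 * s ^ 2 / (l * (1 - p) ^ 2) * (l * z * (1 + l * z) ^ 2) *
          Real.exp (-(l / 2 * z)) ^ 2 := by field_simp
      _ ≤ 2 * s ^ 2 / (l * (1 - p) ^ 2) * (216 * Real.exp (l * z / 2)) *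
          Real.exp (-(l / 2 * z)) ^ 2 := by gcongr
      _ = _ := by rw [← h9]; ring

end IsStep

/-! ### Smoothing by the mixture and expansion of the `n`-th power. -/

/-- Since `C(n, j)/(j + 1) = C(n + 1, j + 1)/(n + 1)`, the sum is `1/(n + 1)` times the binomial
expansion of `(w + r)^(n+1)` without its zeroth term. -/
theorem sum_choose_div_le {w r : ℝ} (hr : 0 ≤ r) (hwr : w + r = 1) (n : ℕ) :
    ∑ j ∈ Finset.range (n + 1), w ^ (j + 1) * r ^ (n - j) * n.choose j / (j + 1) ≤
      1 / (n + 1) := by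
  have h := add_pow w r (n + 1)
  rw [hwr, one_pow, Finset.sum_range_succ'] at h
  have e : ∀ j ∈ Finset.range (n + 1), w ^ (j + 1) * r ^ (n + 1 - (j + 1)) *
      ((n + 1).choose (j + 1) : ℕ) =
        (n + 1) * (w ^ (j + 1) * r ^ (n - j) * n.choose j / (j + 1)) := by
    intro j _
    have h1 : ((n + 1).choose (j + 1) : ℝ) * (j + 1) = (n + 1) * n.choose j := by
      exact_mod_cast (Nat.add_one_mul_choose_eq n j).symm
    rw [Nat.add_sub_add_right]
    field_simp
    linear_combination w ^ (j + 1) * r ^ (n - j) * h1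
  rw [Finset.sum_congr rfl e, ← Finset.mul_sum] at h
  rw [le_div_iff₀ (by positivity), mul_comm]
  have : 0 ≤ w ^ 0 * r ^ (n + 1 - 0) * ((n + 1).choose 0 : ℕ) := by positivity
  linarith

/-- The larger of `i` and `k` is at least `(n - 1)/2`, so a quarter of it still smooths one factor
`W` at rate `1/n`; the other power is a contraction. In fact `n ≤ 8(k/4) + 7` when `k` is the
larger, so `14` is generous. -/
theorem norm_mul_mul_pow_le {A : Type*} [NormedCommRing A] [NormOneClass A] {W F Q : A}
    (hF : ‖F‖ ≤ 1) (hQ : ‖Q‖ ≤ 1) {G : ℝ}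
    (hWF : ∀ i : ℕ, ‖W * F ^ i‖ ≤ G / (i + 1)) (hWQ : ∀ i : ℕ, ‖W * Q ^ i‖ ≤ G / (i + 1))
    {i k n : ℕ} (hn : i + k + 1 = n) :
    ‖W * (F ^ (i / 4) * Q ^ (k / 4))‖ ≤ 14 * G / n := by
  have hpow : ∀ {x : A}, ‖x‖ ≤ 1 → ∀ j : ℕ, ‖x ^ j‖ ≤ 1 := fun hx j =>
    (norm_pow_le _ _).trans (pow_le_one₀ (norm_nonneg _) hx)
  have hG : 0 ≤ G := by
    have := (norm_nonneg _).trans (hWF 0)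
    simpa using this
  have hn0 : (0 : ℝ) < n := by exact_mod_cast (by omega : 0 < n)
  rcases le_total i k with h | h
  · calc _ = ‖W * Q ^ (k / 4) * F ^ (i / 4)‖ := by ring_nf
      _ ≤ G / ((k / 4 : ℕ) + 1) * 1 := by
          refine (norm_mul_le _ _).trans ?_
          gcongr
          · exact hWQ _
          · exact hpow hF _
      _ ≤ _ := by
          rw [mul_one, div_le_div_iff₀ (by positivity) hn0]
          have : (n : ℝ) ≤ 14 * ((k / 4 : ℕ) + 1) := by exact_mod_cast (by omega)
          nlinarith
  · calc _ = ‖W * F ^ (i / 4) * Q ^ (k / 4)‖ := by ring_nf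
      _ ≤ G / ((i / 4 : ℕ) + 1) * 1 := by
          refine (norm_mul_le _ _).trans ?_
          gcongr
          · exact hWF _
          · exact hpow hQ _
      _ ≤ _ := by
          rw [mul_one, div_le_div_iff₀ (by positivity) hn0]
          have : (n : ℝ) ≤ 14 * ((i / 4 : ℕ) + 1) := by exact_mod_cast (by omega)
          nlinarith

/-- The powers are cut into four equal parts plus a remainder, and each factor `W` receives its own
quarter. -/
theorem norm_pow_mul_mul_pow_le {A : Type*} [NormedCommRing A] [NormOneClass A] {W F Q : A}
    (hF : ‖F‖ ≤ 1) (hQ : ‖Q‖ ≤ 1) {G : ℝ}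
    (hWF : ∀ i : ℕ, ‖W * F ^ i‖ ≤ G / (i + 1)) (hWQ : ∀ i : ℕ, ‖W * Q ^ i‖ ≤ G / (i + 1))
    {i k n : ℕ} (hn : i + k + 1 = n) :
    ‖W ^ 3 * (F ^ i * Q ^ k)‖ ≤ (14 * G / n) ^ 3 ∧ ‖W ^ 4 * (F ^ i * Q ^ k)‖ ≤
        (14 * G / n) ^ 4 := by
  have hpow : ∀ {x : A}, ‖x‖ ≤ 1 → ∀ j : ℕ, ‖x ^ j‖ ≤ 1 := fun hx j =>
    (norm_pow_le _ _).trans (pow_le_one₀ (norm_nonneg _) hx)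
  have key := norm_mul_mul_pow_le hF hQ hWF hWQ hn
  have hmul : ∀ {x y : A}, ‖x‖ ≤ 1 → ‖y‖ ≤ 1 → ‖x * y‖ ≤ 1 := fun hx hy =>
    (norm_mul_le _ _).trans (mul_le_one₀ hx (norm_nonneg _) hy)
  have hrest : ‖F ^ (i % 4) * Q ^ (k % 4)‖ ≤ 1 := hmul (hpow hF _) (hpow hQ _)
  have hquo : ‖F ^ (i / 4) * Q ^ (k / 4)‖ ≤ 1 := hmul (hpow hF _) (hpow hQ _)
  have hi : F ^ i = (F ^ (i / 4)) ^ 4 * F ^ (i % 4) := by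
    rw [← pow_mul, ← pow_add]; congr 1; omega
  have hk : Q ^ k = (Q ^ (k / 4)) ^ 4 * Q ^ (k % 4) := by
    rw [← pow_mul, ← pow_add]; congr 1; omega
  rw [hi, hk]
  constructor
  · calc _ = ‖(W * (F ^ (i / 4) * Q ^ (k / 4))) ^ 3 *
          ((F ^ (i / 4) * Q ^ (k / 4)) * (F ^ (i % 4) * Q ^ (k % 4)))‖ := by congr 1; ring
      _ ≤ (14 * G / n) ^ 3 * 1 := by
          refine (norm_mul_le _ _).trans (mul_le_mul ?_ (hmul hquo hrest) (norm_nonneg _)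
            (pow_nonneg ((norm_nonneg _).trans key) _))
          exact (norm_pow_le _ _).trans (pow_le_pow_left₀ (norm_nonneg _) key _)
      _ = _ := mul_one _
  · calc _ = ‖(W * (F ^ (i / 4) * Q ^ (k / 4))) ^ 4 * (F ^ (i % 4) * Q ^ (k % 4))‖ := by
          congr 1; ring
      _ ≤ (14 * G / n) ^ 4 * 1 := by
          refine (norm_mul_le _ _).trans (mul_le_mul ?_ hrest (norm_nonneg _)
            (pow_nonneg ((norm_nonneg _).trans key) _))
          exact (norm_pow_le _ _).trans (pow_le_pow_left₀ (norm_nonneg _) key _)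
      _ = _ := mul_one _

section Algebra

variable {A : Type*} [NormedCommRing A] [NormedAlgebra ℝ A] [CompleteSpace A] [NormOneClass A]

/-- The atom at zero is merged with the one direction: `q + pX = wY`, where `Y` is a lazy step of
parameter `p/w` and `w = q + p`. Expanding `(wY + R)^n` binomially, each `Y^j` smooths `X - 1` at
rate `1/(j + 1)`, and the binomial average of these rates is at most a multiple of `1/(n + 1)`.
Laziness `1 - p/w = q/w` produces the factor `q^{3/2}`. -/
theorem IsStep.norm_diff_mul_pow_mixture_le {a : ℤ → ℝ} (ha : IsStep a) {u : Aˣ}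
    (hu : ∀ k : ℤ, ‖((u ^ k : Aˣ) : A)‖ ≤ 1) {p q : ℝ} (hp : 0 < p) (hq : 0 < q) {R : A}
    (hR : ‖R‖ ≤ 1 - (q + p)) (n : ℕ) :
    ‖p • (ev u a - 1) * (q • 1 + p • ev u a + R) ^ n‖ ≤
      100 * √(1 + stepSigma a) / (q * √q) / (n + 1) := by
  set w := q + p with hw
  have hw0 : 0 < w := by positivity
  have hw1 : w ≤ 1 := by linarith [norm_nonneg R]
  set s := √(1 + stepSigma a) with hs
  have hs2 : s ^ 2 = 1 + stepSigma a := Real.sq_sqrt (by linarith [ha.one_le_sigma])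
  set X := ev u a
  set Y := 1 + (p / w) • (X - 1) with hY
  have hdec : q • 1 + p • X = w • Y := by
    rw [hY, smul_add, smul_smul, mul_div_cancel₀ _ hw0.ne', hw, add_smul, smul_sub]
    abel
  have hM : ∀ j : ℕ, p * ‖(X - 1) * Y ^ j‖ ≤ 100 * s * w / (q * √q * (j + 1)) := by
    intro j
    have h := ha.sq_norm_diff_mul_pow_le hu (p := p / w) (by positivity)
      (by rw [div_lt_one hw0]; linarith) j
    rw [← hs2] at h
    have e : 1 - p / w = q / w := by field_simp; linarith
    rw [e] at h
    rw [le_div_iff₀ (by positivity)]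
    have hsq : √q ^ 2 = q := Real.sq_sqrt hq.le
    set M := ‖(X - 1) * Y ^ j‖
    refine le_of_sq_le_sq ?_ (by positivity)
    calc (p * M * (q * √q * (j + 1))) ^ 2
        = w ^ 5 * ((M * ((j + 1) * (q / w * (p / w)))) ^ 2 * (q / w)) := by
          have : (p * M * (q * √q * (j + 1))) ^ 2 = (p * M * (q * (j + 1))) ^ 2 * √q ^ 2 := by ring
          rw [this, hsq]
          field_simp
      _ ≤ w ^ 2 * (10 ^ 4 * s ^ 2) := by
          refine mul_le_mul (pow_le_pow_of_le_one hw0.le hw1 (by norm_num)) h (by positivity)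
            (by positivity)
      _ = (100 * s * w) ^ 2 := by ring
  rw [hdec, (Commute.all (w • Y) R).add_pow, Finset.mul_sum]
  calc _ ≤ ∑ j ∈ Finset.range (n + 1), 100 * s / (q * √q) *
        (w ^ (j + 1) * (1 - w) ^ (n - j) * n.choose j / (j + 1)) := by
        refine norm_sum_le_of_le _ fun j _ => ?_
        have e : p • (X - 1) * ((w • Y) ^ j * R ^ (n - j) * (n.choose j : A)) =
            (p * w ^ j * n.choose j) • ((X - 1) * Y ^ j * R ^ (n - j)) := by
          simp only [Algebra.smul_def, map_mul, map_pow, map_natCast]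
          ring_nf
        rw [e, norm_smul, Real.norm_eq_abs, abs_of_nonneg (by positivity)]
        calc _ ≤ p * w ^ j * n.choose j * (‖(X - 1) * Y ^ j‖ * (1 - w) ^ (n - j)) := by
              gcongr
              refine (norm_mul_le _ _).trans ?_
              gcongr
              exact (norm_pow_le _ _).trans (pow_le_pow_left₀ (norm_nonneg _) hR _)
          _ = (p * ‖(X - 1) * Y ^ j‖) * (w ^ j * n.choose j * (1 - w) ^ (n - j)) := by ring
          _ ≤ 100 * s * w / (q * √q * (j + 1)) * (w ^ j * n.choose j * (1 - w) ^ (n - j)) := by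
              have : 0 ≤ 1 - w := by linarith
              gcongr
              exact hM j
          _ = _ := by
              field_simp
              ring
    _ ≤ _ := by
        rw [← Finset.mul_sum]
        refine (mul_le_mul_of_nonneg_left (sum_choose_div_le (by linarith) (by ring) n)
          (by positivity)).trans_eq ?_
        ring

/-- The exponential factorises and the part with `R - r` is a contraction. Running the single
direction for time `tp` cancels the weight `p`, so neither `p` nor `q` survives in the bound. -/
theorem IsStep.norm_diff_mul_exp_mixture_le {a : ℤ → ℝ} (ha : IsStep a) {u : Aˣ}
    (hu : ∀ k : ℤ, ‖((u ^ k : Aˣ) : A)‖ ≤ 1) {p r t : ℝ} (hp : 0 < p) (ht : 0 < t) {R : A}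
    (hR : ‖R‖ ≤ r) :
    ‖p • (ev u a - 1) * NormedSpace.exp (t • (p • (ev u a - 1) + (R - r • 1)))‖ ≤
      √1.76 * √(1 + stepSigma a) / t := by
  rw [smul_add, exp_add_real, ← mul_assoc]
  have h1 := ha.sq_norm_diff_mul_exp_le hu (t := t * p) (by positivity)
  rw [← Real.sqrt_mul (by norm_num), le_div_iff₀ ht]
  apply Real.le_sqrt_of_sq_le
  refine le_trans ?_ h1
  have h2 := norm_exp_smul_sub_le_one (t := t) hR ht.le
  gcongr ?_ ^ 2
  calc _ ≤ ‖p • (ev u a - 1) * NormedSpace.exp (t • p • (ev u a - 1))‖ *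
        ‖NormedSpace.exp (t • (R - r • 1))‖ * t := by gcongr; exact norm_mul_le _ _
    _ ≤ ‖p • (ev u a - 1) * NormedSpace.exp (t • p • (ev u a - 1))‖ * 1 * t := by gcongr
    _ = _ := by
        rw [smul_mul_assoc, norm_smul, Real.norm_eq_abs, abs_of_pos hp, smul_smul]
        ring

/-- Taylor's formula for the exponential. -/
theorem exists_exp_remainder (W : A) (k : ℕ) : ∃ E : A, ‖E‖ ≤ Real.exp ‖W‖ ∧
    NormedSpace.exp W = ∑ i ∈ Finset.range k, (i ! : ℝ)⁻¹ • W ^ i + W ^ k * E := by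
  set f : ℕ → A := fun n => (n ! : ℝ)⁻¹ • W ^ n with hf
  set g : ℕ → A := fun n => ((n + k).factorial : ℝ)⁻¹ • W ^ n with hg
  have hfg : ∀ n, f (n + k) = W ^ k * g n := fun n => by
    rw [hf, hg, mul_smul_comm, ← pow_add, add_comm k n]
  have hle : ∀ n : ℕ, ‖g n‖ ≤ (n ! : ℝ)⁻¹ • ‖W‖ ^ n := by
    intro n
    rw [hg, norm_smul, smul_eq_mul, norm_inv, Real.norm_natCast]
    have h1 : (n.factorial : ℝ) ≤ (n + k).factorial := by
      exact_mod_cast Nat.factorial_le (Nat.le_add_right n k)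
    have h2 : ‖W ^ n‖ ≤ ‖W‖ ^ n := norm_pow_le _ _
    gcongr
  have h2 := hasSum_exp_real (B := ℝ) ‖W‖
  rw [← Real.exp_eq_exp_ℝ] at h2
  have h : HasSum f (NormedSpace.exp W) := hasSum_exp_real W
  clear_value f g
  have hgs : Summable g := Summable.of_norm_bounded h2.summable hle
  refine ⟨∑' n, g n, tsum_of_norm_bounded h2 hle, ?_⟩
  rw [← h.tsum_eq, ← h.summable.sum_add_tsum_nat_add k, ← hgs.tsum_mul_left]
  rw [tsum_congr hfg, hf]

theorem exp_two_le : Real.exp 2 ≤ 9 := by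
  have h := Real.exp_one_lt_d9
  have : Real.exp 2 = Real.exp 1 ^ 2 := by rw [← Real.exp_nat_mul]; norm_num
  rw [this]
  have h0 := Real.exp_pos 1
  nlinarith

/-- Second order expansion of `(1 + W)^n` around `exp{nW}`. -/
theorem norm_expansion_le {W : A} (hF : ‖1 + W‖ ≤ 1) (hQ : ‖NormedSpace.exp W‖ ≤ 1) {G : ℝ}
    (hWF : ∀ i : ℕ, ‖W * (1 + W) ^ i‖ ≤ G / (i + 1))
    (hWQ : ∀ i : ℕ, ‖W * NormedSpace.exp W ^ i‖ ≤ G / (i + 1)) (n : ℕ) :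
    ‖(1 + W) ^ n - NormedSpace.exp W ^ n + ((n : ℝ) / 2) • (W ^ 2 * NormedSpace.exp W ^ n)‖ ≤
      19 * n * (14 * G / n) ^ 3 + 9 / 2 * n ^ 2 * (14 * G / n) ^ 4 := by
  have hW : ‖W‖ ≤ 2 := by
    calc ‖W‖ = ‖(1 + W) - 1‖ := by congr 1; ring
      _ ≤ 1 + 1 := (norm_sub_le _ _).trans (by rw [norm_one]; gcongr)
      _ = 2 := by norm_num
  have hexp : Real.exp ‖W‖ ≤ 9 := (Real.exp_le_exp.2 hW).trans exp_two_le
  obtain ⟨E2, hE2, h2⟩ := exists_exp_remainder W 2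
  obtain ⟨E3, hE3, h3⟩ := exists_exp_remainder W 3
  simp only [Finset.sum_range_succ, Finset.sum_range_zero, Nat.factorial, zero_add, pow_zero,
    pow_one, Nat.cast_one, inv_one, one_smul, mul_one] at h2 h3
  norm_num at h3
  set F := 1 + W with hFdef
  set Q := NormedSpace.exp W with hQdef
  have hD2 : F - Q = -(W ^ 2 * E2) := by rw [h2]; ring
  set H : A := (1 / 2 : ℝ) • 1 with hH
  have hHm : ∀ x : A, (1 / 2 : ℝ) • x = H * x := fun x => by rw [hH, smul_mul_assoc, one_mul]
  have hHnorm : ‖H‖ ≤ 1 / 2 := by rw [hH, norm_smul, norm_one]; norm_num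
  set D3 : A := -E3 + H + H * (W * E2) with hD3def
  -- The leading part of `F - Q` is written with an extra factor `Q`, at the cost of a third order
  -- term, so that it recombines into `Q ^ n` below. The bound `19 = 9 + 1/2 + 9` uses `exp ‖W‖ ≤ e²
  -- ≤ 9`.
  have hD3 : F - Q + H * (W ^ 2 * Q) = W ^ 3 * D3 := by
    have e1 : F - Q = -(H * W ^ 2) - W ^ 3 * E3 := by
      rw [h3, hHm]; ring
    rw [e1]
    conv_lhs => rw [h2]
    ring
  have hD3n : ‖D3‖ ≤ 19 := by
    have t1 : ‖H * (W * E2)‖ ≤ 1 / 2 * (2 * 9) := by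
      refine (norm_mul_le _ _).trans (mul_le_mul hHnorm ?_ (norm_nonneg _) (by norm_num))
      exact (norm_mul_le _ _).trans (mul_le_mul hW (hE2.trans hexp) (norm_nonneg _) (by norm_num))
    calc ‖D3‖ ≤ ‖E3‖ + ‖H‖ + ‖H * (W * E2)‖ := by
          refine (norm_add_le _ _).trans ?_
          gcongr
          exact (norm_add_le _ _).trans (by rw [norm_neg])
      _ ≤ 9 + 1 / 2 + 1 / 2 * (2 * 9) := by
          gcongr
          exact hE3.trans hexp
      _ ≤ 19 := by norm_num
  have bound := fun {i k : ℕ} (h : i + k + 1 = n) => norm_pow_mul_mul_pow_le hF hQ hWF hWQ h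
  -- Telescoping is used twice: once for `F^n - Q^n`, and again for the error `F^j - Q^j` made in
  -- replacing `F^j` by `Q^j` next to `W²`; the second use brings another `W²`.
  have hterm : ∀ j ∈ Finset.range n, F ^ j * Q ^ (n - 1 - j) * (F - Q) + H * (W ^ 2 * Q ^ n) =
      W ^ 3 * (F ^ j * Q ^ (n - 1 - j)) * D3 +
        ∑ i ∈ Finset.range j, W ^ 4 * (F ^ i * Q ^ (n - 1 - i)) * (H * E2) := by
    intro j hj
    have hj' := Finset.mem_range.1 hj
    have g := geom_sum₂_mul F Q j
    have hsum : ∑ i ∈ Finset.range j, W ^ 4 * (F ^ i * Q ^ (n - 1 - i)) * (H * E2) =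
        -(H * W ^ 2 * Q ^ (n - j) * (F ^ j - Q ^ j)) := by
      rw [← g, hD2, Finset.sum_mul, Finset.mul_sum, ← Finset.sum_neg_distrib]
      refine Finset.sum_congr rfl fun i hi => ?_
      have hi' := Finset.mem_range.1 hi
      have : Q ^ (n - 1 - i) = Q ^ (n - j) * Q ^ (j - 1 - i) := by
        rw [← pow_add]; congr 1; omega
      rw [this]; ring
    rw [hsum]
    have e1 : Q ^ n = Q ^ (n - j) * Q ^ j := by rw [← pow_add]; congr 1; omega
    have e2 : Q ^ (n - j) = Q ^ (n - 1 - j) * Q := by rw [← pow_succ]; congr 1; omega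
    rw [e1, e2]
    linear_combination F ^ j * Q ^ (n - 1 - j) * hD3
  have hmain : F ^ n - Q ^ n + ((n : ℝ) / 2) • (W ^ 2 * Q ^ n) =
      ∑ j ∈ Finset.range n, (W ^ 3 * (F ^ j * Q ^ (n - 1 - j)) * D3 +
        ∑ i ∈ Finset.range j, W ^ 4 * (F ^ i * Q ^ (n - 1 - i)) * (H * E2)) := by
    rw [← Finset.sum_congr rfl hterm, Finset.sum_add_distrib, ← Finset.sum_mul, geom_sum₂_mul,
      Finset.sum_const, Finset.card_range, ← hHm, ← Nat.cast_smul_eq_nsmul ℝ, smul_smul]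
    congr 2; ring
  rw [hmain]
  have hε : 0 ≤ 14 * G / n := by
    have := (norm_nonneg _).trans (hWF 0)
    have : 0 ≤ G := by simpa using this
    positivity
  calc _ ≤ ∑ j ∈ Finset.range n, ((14 * G / n) ^ 3 * 19 +
      n * ((14 * G / n) ^ 4 * (1 / 2 * 9))) := by
        refine norm_sum_le_of_le _ fun j hj => ?_
        have hj' := Finset.mem_range.1 hj
        refine (norm_add_le _ _).trans (add_le_add ?_ ?_)
        · exact (norm_mul_le _ _).trans
            (mul_le_mul (bound (by omega)).1 hD3n (norm_nonneg _) (by positivity))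
        · calc _ ≤ ∑ i ∈ Finset.range j, (14 * G / n) ^ 4 * (1 / 2 * 9) := by
                refine norm_sum_le_of_le _ fun i hi => ?_
                have hi' := Finset.mem_range.1 hi
                refine (norm_mul_le _ _).trans
                  (mul_le_mul (bound (by omega)).2 ?_ (norm_nonneg _) (by positivity))
                exact (norm_mul_le _ _).trans
                  (mul_le_mul hHnorm (hE2.trans hexp) (norm_nonneg _) (by norm_num))
            _ = j * ((14 * G / n) ^ 4 * (1 / 2 * 9)) := by simp
            _ ≤ _ := by gcongr
    _ = _ := by
        rw [Finset.sum_const, Finset.card_range, nsmul_eq_mul]; ring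

/-- The absolute constant of the main estimate. -/
noncomputable def mainConst : ℝ := 20 * 1400 ^ 4

/-- In terms of `x = S/√n` the claim is a bound by `1.76 x²` plus a multiple of `x³/q⁵`. For `x > q`
the second term already exceeds the trivial bound `1`; for `x ≤ q` the second order expansion
applies. -/
theorem norm_mixture_sub_exp_le {W : A} {q S : ℝ} (hq : 0 < q) (hq1 : q ≤ 1) (hS : 0 ≤ S)
    (hF : ‖1 + W‖ ≤ 1) (hQ : ∀ t : ℝ, 0 ≤ t → ‖NormedSpace.exp (t • W)‖ ≤ 1)
    (hWF : ∀ i : ℕ, ‖W * (1 + W) ^ i‖ ≤ 100 * S / (q * √q) / (i + 1))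
    (hWQ : ∀ t : ℝ, 0 < t → ‖W * NormedSpace.exp (t • W)‖ ≤ √1.76 * S / t) {n : ℕ} (hn : 1 ≤ n) :
    ‖(1 + W) ^ n - NormedSpace.exp ((n : ℝ) • W)‖ / 2 ≤
      1.76 / n * S ^ 2 * (1 + mainConst / (√n * q ^ 5) * S) := by
  have hn0 : (0 : ℝ) < n := by exact_mod_cast hn
  have hn1 : (1 : ℝ) ≤ n := by exact_mod_cast hn
  set ρ := √(n : ℝ) with hρ
  have hρ2 : ρ ^ 2 = n := Real.sq_sqrt hn0.le
  have hρ0 : 0 < ρ := Real.sqrt_pos.2 hn0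
  have hρ1 : 1 ≤ ρ := by apply Real.le_sqrt_of_sq_le; simpa using hn1
  set κ := √q with hκ
  have hκ2 : κ ^ 2 = q := Real.sq_sqrt hq.le
  have hκ0 : 0 < κ := Real.sqrt_pos.2 hq
  have hκ1 : κ ≤ 1 := Real.sqrt_le_iff.2 ⟨zero_le_one, by linarith⟩
  set x := S / ρ with hx
  have hx0 : 0 ≤ x := by positivity
  have hSx : S = x * ρ := by rw [hx]; field_simp
  have hC : 0 < mainConst := by unfold mainConst; norm_num
  have hrhs : 1.76 / n * S ^ 2 * (1 + mainConst / (ρ * q ^ 5) * S) =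
      1.76 * x ^ 2 + 1.76 * mainConst * (x ^ 3 / q ^ 5) := by
    rw [hSx, ← hρ2]; field_simp
  rw [hrhs]
  rcases lt_or_ge q x with hqx | hxq
  · have h1 : ‖(1 + W) ^ n - NormedSpace.exp ((n : ℝ) • W)‖ ≤ 1 + 1 :=
      (norm_sub_le _ _).trans (add_le_add
        ((norm_pow_le _ _).trans (pow_le_one₀ (norm_nonneg _) hF)) (hQ _ hn0.le))
    have h2 : 1 ≤ x ^ 3 / q ^ 5 := by
      rw [le_div_iff₀ (by positivity), one_mul]
      calc q ^ 5 ≤ q ^ 3 := pow_le_pow_of_le_one hq.le hq1 (by norm_num)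
        _ ≤ x ^ 3 := by gcongr
    have h3 : 1 ≤ 1.76 * mainConst := by unfold mainConst; norm_num
    nlinarith [sq_nonneg x]
  · have hQ1 : ‖NormedSpace.exp W‖ ≤ 1 := by simpa using hQ 1 zero_le_one
    have h176 : √1.76 ≤ 2 := by
      rw [Real.sqrt_le_left (by norm_num)]; norm_num
    set G := 100 * S / (q * κ) with hG
    have hWQ' : ∀ i : ℕ, ‖W * NormedSpace.exp W ^ i‖ ≤ G / (i + 1) := by
      intro i
      rcases Nat.eq_zero_or_pos i with rfl | hi
      · simpa using hWF 0
      · have hi0 : (1 : ℝ) ≤ i := by exact_mod_cast hi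
        rw [← exp_nsmul_real]
        refine (hWQ i (by linarith)).trans ?_
        have hqk : q * κ ≤ 1 := by nlinarith
        have : 100 * S ≤ G := by
          rw [hG, le_div_iff₀ (by positivity)]
          nlinarith
        rw [div_le_div_iff₀ (by linarith) (by linarith)]
        calc √1.76 * S * (i + 1) ≤ 2 * S * (2 * i) := by gcongr; linarith
          _ ≤ 100 * S * i := by nlinarith [mul_nonneg hS (by linarith : (0 : ℝ) ≤ i)]
          _ ≤ _ := by gcongr
    have hexp := norm_expansion_le hF hQ1 hWF hWQ' n
    rw [← exp_nsmul_real] at hexp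
    -- Splitting `exp(nW)` evenly between the two factors `W` gives `(n/2)(√1.76 S/(n/2))² = 2 ·
    -- 1.76 S²/n`; the factor `2` is removed by the halving in the total variation distance.
    have hmain : ‖((n : ℝ) / 2) • (W ^ 2 * NormedSpace.exp ((n : ℝ) • W))‖ ≤
        2 * (1.76 * x ^ 2) := by
      have hh := hWQ (n / 2) (by positivity)
      have e : W ^ 2 * NormedSpace.exp ((n : ℝ) • W) =
          (W * NormedSpace.exp (((n : ℝ) / 2) • W)) ^ 2 := by
        rw [mul_pow, pow_two (NormedSpace.exp _), ← exp_add_real, ← add_smul, add_halves]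
      rw [e, norm_smul, Real.norm_eq_abs, abs_of_pos (by positivity)]
      calc _ ≤ (n : ℝ) / 2 * (√1.76 * S / (n / 2)) ^ 2 := by
            gcongr
            exact (norm_pow_le _ _).trans (pow_le_pow_left₀ (norm_nonneg _) hh 2)
        _ = (n : ℝ) / 2 * (√1.76 ^ 2 * S ^ 2 / (n / 2) ^ 2) := by rw [div_pow, mul_pow]
        _ = _ := by
            rw [Real.sq_sqrt (by norm_num), hSx, ← hρ2]
            field_simp
    have hε : 14 * G / n = 1400 * x / (ρ * q * κ) := by
      rw [hG, hSx, ← hρ2]; field_simp; ring_nf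
    rw [hε] at hexp
    -- The cubic error is of order `x³/(√n q^{9/2})`, at most `x³/q⁵`. The quartic one is of order
    -- `x⁴/q⁶`, and there `x ≤ q` trades one `x` for one `q`: this fixes the power `q⁵`.
    have t1 : 19 * n * (1400 * x / (ρ * q * κ)) ^ 3 ≤ 19 * 1400 ^ 3 * (x ^ 3 / q ^ 5) := by
      have : 19 * n * (1400 * x / (ρ * q * κ)) ^ 3 = 19 * 1400 ^ 3 * (x ^ 3 / (ρ * κ * q ^ 4)) := by
        rw [← hρ2, ← hκ2]; field_simp
      rw [this]
      gcongr
      have : q ≤ κ := by rw [← hκ2]; nlinarith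
      calc q ^ 5 = 1 * q * q ^ 4 := by ring
        _ ≤ ρ * κ * q ^ 4 := by gcongr
    have t2 : 9 / 2 * n ^ 2 * (1400 * x / (ρ * q * κ)) ^ 4 ≤
        9 / 2 * 1400 ^ 4 * (x ^ 3 / q ^ 5) := by
      have : 9 / 2 * n ^ 2 * (1400 * x / (ρ * q * κ)) ^ 4 =
          9 / 2 * 1400 ^ 4 * (x ^ 3 * x / q ^ 6) := by
        rw [← hρ2, ← hκ2]; field_simp
      rw [this]
      gcongr ?_ * ?_
      rw [div_le_div_iff₀ (by positivity) (by positivity)]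
      calc x ^ 3 * x * q ^ 5 ≤ x ^ 3 * q * q ^ 5 := by gcongr
        _ = _ := by ring
    have htri : ‖(1 + W) ^ n - NormedSpace.exp ((n : ℝ) • W)‖ ≤
        ‖(1 + W) ^ n - NormedSpace.exp ((n : ℝ) • W) +
          ((n : ℝ) / 2) • (W ^ 2 * NormedSpace.exp ((n : ℝ) • W))‖ +
        ‖((n : ℝ) / 2) • (W ^ 2 * NormedSpace.exp ((n : ℝ) • W))‖ := norm_le_add_norm_add _ _
    have hx3 : 0 ≤ x ^ 3 / q ^ 5 := by positivity
    have hfin : 19 * 1400 ^ 3 * (x ^ 3 / q ^ 5) + 9 / 2 * 1400 ^ 4 * (x ^ 3 / q ^ 5) ≤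
        2 * (1.76 * mainConst * (x ^ 3 / q ^ 5)) := by
      rw [← add_mul, ← mul_assoc]
      gcongr
      unfold mainConst; norm_num
    linarith

end Algebra

/-! ### Convolution of signed measures as an integral of translates. -/

section Conv

variable {E : Type*} [AddMonoid E] [MeasurableSpace E] [MeasurableAdd₂ E]

theorem measurable_translate (M : SignedMeasure E) {B : Set E} (hB : MeasurableSet B) :
    StronglyMeasurable fun y => M ((fun x => x + y) ⁻¹' B) := by
  have hs : MeasurableSet ((fun z : E × E => z.2 + z.1) ⁻¹' B) :=
    (measurable_snd.add measurable_fst) hB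
  exact VectorMeasure.stronglyMeasurable_vectorMeasure_prodMk_left (ν := M) hs

theorem integrable_translate (M : SignedMeasure E) {B : Set E} (hB : MeasurableSet B)
    (μ : Measure E) [IsFiniteMeasure μ] :
    Integrable (fun y => M ((fun x => x + y) ⁻¹' B)) μ :=
  Integrable.of_bound (measurable_translate M hB).aestronglyMeasurable M.bound
    (Filter.Eventually.of_forall fun _ => VectorMeasure.norm_apply_le_bound)

theorem conv_toSignedMeasure_apply (M : SignedMeasure E) (μ : Measure E) [IsFiniteMeasure μ]
    {B : Set E} (hB : MeasurableSet B) :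
    conv M μ.toSignedMeasure B = ∫ y, M ((fun x => x + y) ⁻¹' B) ∂μ := by
  have hadd : Measurable fun z : E × E => z.1 + z.2 := measurable_fst.add measurable_snd
  -- The slicing formula integrates over the first factor, so the positive measure `μ` is moved
  -- there.
  have hswap : M.prod μ.toSignedMeasure (ContinuousLinearMap.mul ℝ ℝ) =
      ((μ.toSignedMeasure).prod M (ContinuousLinearMap.mul ℝ ℝ)).map Prod.swap := by
    apply VectorMeasure.prod_eq_of_forall_apply_prod
    intro s t hs ht
    rw [VectorMeasure.map_apply _ measurable_swap (hs.prod ht), Set.preimage_swap_prod,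
      VectorMeasure.prod_apply]
    simp [mul_comm]
  rw [conv, VectorMeasure.map_apply _ hadd hB, hswap,
    VectorMeasure.map_apply _ measurable_swap (hadd hB),
    VectorMeasure.prod_apply_eq_integral (measurable_swap (hadd hB)),
    ← VectorMeasure.integral_toSignedMeasure]
  rfl

theorem conv_smul_sub_apply (M V V' : SignedMeasure E) (c : ℝ) {B : Set E}
    (hB : MeasurableSet B) :
    conv M (c • (V - V')) B = c * (conv M V B - conv M V' B) := by
  have hadd : Measurable fun z : E × E => z.1 + z.2 := measurable_fst.add measurable_snd
  have h : M.prod (c • (V - V')) (ContinuousLinearMap.mul ℝ ℝ) =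
      c • (M.prod V (ContinuousLinearMap.mul ℝ ℝ) - M.prod V' (ContinuousLinearMap.mul ℝ ℝ)) := by
    apply VectorMeasure.prod_eq_of_forall_apply_prod
    intro s t hs ht
    simp [VectorMeasure.prod_apply]
    ring
  rw [conv, conv, conv, VectorMeasure.map_apply _ hadd hB, VectorMeasure.map_apply _ hadd hB,
    VectorMeasure.map_apply _ hadd hB, h]
  simp

theorem conv_unitMass_zero_apply (M : SignedMeasure E) {B : Set E} (hB : MeasurableSet B) :
    conv M (unitMass 0) B = M B := by
  rw [unitMass, conv_toSignedMeasure_apply _ _ hB,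
    integral_dirac' _ _ (measurable_translate M hB)]
  simp

end Conv

/-! ### The commutative Banach algebra of translations. -/

section Operators

variable (E : Type*) [AddCommGroup E]

/-- Bounded functions on `E`. -/
abbrev BddFun := lp (fun _ : E => ℝ) ∞

variable {E}

theorem memℓp_translate (a : E) (g : BddFun E) : Memℓp (fun x => g (x + a)) ∞ := by
  refine memℓp_infty ⟨‖g‖, ?_⟩
  rintro _ ⟨x, rfl⟩
  exact lp.norm_apply_le_norm ENNReal.top_ne_zero g (x + a)

/-- Translation of bounded functions. -/
noncomputable def translate (a : E) : BddFun E →L[ℝ] BddFun E :=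
  LinearMap.mkContinuous
    { toFun := fun g => ⟨fun x => g (x + a), memℓp_translate a g⟩
      map_add' := fun _ _ => rfl
      map_smul' := fun _ _ => rfl } 1 fun g => by
    rw [one_mul]
    exact lp.norm_le_of_forall_le (norm_nonneg _) fun x =>
      lp.norm_apply_le_norm ENNReal.top_ne_zero g (x + a)

theorem translate_apply (a : E) (g : BddFun E) (x : E) : translate a g x = g (x + a) := rfl

theorem norm_translate_le (a : E) : ‖translate a‖ ≤ 1 :=
  LinearMap.mkContinuous_norm_le _ zero_le_one _

theorem translate_mul (a b : E) : translate a * translate b = translate (a + b) := by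
  ext g x
  rw [mul_apply_eq_comp, translate_apply, translate_apply, translate_apply, add_assoc]

theorem translate_zero : translate (0 : E) = 1 := by
  ext g x
  rw [translate_apply, add_zero]; rfl

variable (E) in
/-- The closed algebra of operators generated by the translations. -/
noncomputable def translateAlg : Subalgebra ℝ (BddFun E →L[ℝ] BddFun E) :=
  (Algebra.adjoin ℝ (Set.range (translate (E := E)))).topologicalClosure

theorem translateAlg_mul_comm (x y : translateAlg E) : x * y = y * x := by
  have h := Algebra.isMulCommutative_adjoin ℝ (s := Set.range (translate (E := E))) (by
    rintro _ ⟨a, rfl⟩ _ ⟨b, rfl⟩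
    rw [translate_mul, translate_mul, add_comm])
  let _ := Subalgebra.commRingTopologicalClosure
    (Algebra.adjoin ℝ (Set.range (translate (E := E)))) (fun x y => h.is_comm.comm x y)
  exact mul_comm (G := (Algebra.adjoin ℝ (Set.range (translate (E := E)))).topologicalClosure) x y

variable (E) in
/-- The commutative Banach algebra generated by the translations. -/
def TransAlg : Type _ := translateAlg E

/-- The operator underlying an element of the algebra. -/
noncomputable def TransAlg.op (x : TransAlg E) : BddFun E →L[ℝ] BddFun E := Subtype.val x

noncomputable instance : NormedCommRing (TransAlg E) :=
  { (inferInstance : NormedRing (translateAlg E)) with mul_comm := translateAlg_mul_comm }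

noncomputable instance : NormedAlgebra ℝ (TransAlg E) :=
  { Subalgebra.toNormedAlgebra (translateAlg E) with }

instance : CompleteSpace (TransAlg E) := by
  have h : IsClosed (translateAlg E : Set (BddFun E →L[ℝ] BddFun E)) := isClosed_closure
  exact h.completeSpace_coe

instance : Nontrivial (BddFun E) := by
  refine ⟨⟨0, ⟨fun _ => 1, memℓp_infty ⟨1, ?_⟩⟩, fun h => ?_⟩⟩
  · rintro _ ⟨x, rfl⟩; simp
  · have := congrArg (fun f : BddFun E => f 0) h
    exact zero_ne_one this

instance : NormOneClass (TransAlg E) :=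
  ⟨norm_one (α := BddFun E →L[ℝ] BddFun E)⟩

theorem TransAlg.norm_op (x : TransAlg E) : ‖x.op‖ = ‖x‖ := rfl

theorem TransAlg.ext_op {x z : TransAlg E} (h : x.op = z.op) : x = z := Subtype.ext h

/-- Translation as an element of the algebra. -/
noncomputable def translateElt (a : E) : TransAlg E :=
  ⟨translate a, Subalgebra.le_topologicalClosure _ (Algebra.subset_adjoin ⟨a, rfl⟩)⟩

theorem translateElt_mul (a b : E) : translateElt a * translateElt b = translateElt (a + b) :=
  TransAlg.ext_op (translate_mul a b)

theorem translateElt_zero : translateElt (0 : E) = 1 := TransAlg.ext_op translate_zero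

/-- Translation as a unit of the algebra. -/
noncomputable def translateUnit (a : E) : (TransAlg E)ˣ where
  val := translateElt a
  inv := translateElt (-a)
  val_inv := by rw [translateElt_mul, add_neg_cancel, translateElt_zero]
  inv_val := by rw [translateElt_mul, neg_add_cancel, translateElt_zero]

theorem translateUnit_zpow (a : E) (k : ℤ) : translateUnit a ^ k = translateUnit (k • a) := by
  let f : Multiplicative E →* (TransAlg E)ˣ :=
    { toFun := fun x => translateUnit x.toAdd
      map_one' := Units.ext translateElt_zero
      map_mul' := fun x y => Units.ext (translateElt_mul _ _).symm }
  exact (map_zpow f (Multiplicative.ofAdd a) k).symm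

theorem norm_translateUnit_zpow_le (a : E) (k : ℤ) :
    ‖((translateUnit a ^ k : (TransAlg E)ˣ) : TransAlg E)‖ ≤ 1 := by
  rw [translateUnit_zpow]
  exact norm_translate_le _

/-- The indicator function of a set, as a bounded function. -/
noncomputable def ind (B : Set E) : BddFun E := ⟨B.indicator 1, memℓp_infty ⟨1, by
  rintro _ ⟨x, rfl⟩
  by_cases hx : x ∈ B <;> simp [hx]⟩⟩

theorem translate_ind (a : E) (B : Set E) :
    translate a (ind B) = ind ((fun x => x + a) ⁻¹' B) := by
  rfl

/-- Evaluation of `x 1_B` at the origin. -/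
noncomputable def mass (B : Set E) : TransAlg E →L[ℝ] ℝ :=
  LinearMap.mkContinuous
    { toFun := fun x => x.op (ind B) 0
      map_add' := fun _ _ => rfl
      map_smul' := fun _ _ => rfl } ‖ind B‖ fun x => by
    rw [mul_comm, ← TransAlg.norm_op]
    exact (lp.norm_apply_le_norm ENNReal.top_ne_zero _ _).trans (x.op.le_opNorm _)

theorem mass_apply (B : Set E) (x : TransAlg E) : mass B x = x.op (ind B) 0 := rfl

theorem mass_one (B : Set E) : mass B (1 : TransAlg E) = B.indicator 1 0 := rfl

theorem mass_mul_translateUnit (B : Set E) (x : TransAlg E) (a : E) :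
    mass B (x * translateUnit a) = mass ((fun x => x + a) ⁻¹' B) x := by
  rw [mass_apply, mass_apply, ← translate_ind]; rfl

/-- As `x` has total mass zero, the indicator of `B` may be replaced by the indicator minus `1/2`,
whose sup norm is at most `1/2`. This halving is needed for the constant `1.76`. -/
theorem abs_mass_le {x : TransAlg E} (hx : mass Set.univ x = 0) (B : Set E) :
    |mass B x| ≤ ‖x‖ / 2 := by
  have h1 : mass B x = x.op (ind B - (1 / 2 : ℝ) • ind Set.univ) 0 := by
    rw [map_sub, map_smul]
    change mass B x = mass B x - (1 / 2 : ℝ) * mass Set.univ x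
    rw [hx]; ring
  have h2 : ‖ind B - (1 / 2 : ℝ) • ind (Set.univ : Set E)‖ ≤ 1 / 2 := by
    refine lp.norm_le_of_forall_le (by norm_num) fun y => ?_
    change ‖B.indicator (1 : E → ℝ) y - (1 / 2 : ℝ) * Set.univ.indicator (1 : E → ℝ) y‖ ≤ 1 / 2
    by_cases hy : y ∈ B <;> simp only [hy, Set.indicator_of_mem, Set.indicator_of_notMem,
      not_false_eq_true, Set.mem_univ, Pi.one_apply] <;> norm_num
  rw [h1, ← TransAlg.norm_op]
  calc _ ≤ ‖x.op (ind B - (1 / 2 : ℝ) • ind Set.univ)‖ :=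
        lp.norm_apply_le_norm ENNReal.top_ne_zero _ _
    _ ≤ ‖x.op‖ * (1 / 2) := (x.op.le_opNorm _).trans (by gcongr)
    _ = _ := by rw [mul_one_div]

end Operators

/-! ### The norm estimate for several directions. -/

theorem norm_mixture_pow_sub_exp_le {A : Type*} [NormedCommRing A] [NormedAlgebra ℝ A]
    [CompleteSpace A] [NormOneClass A] {ι : Type*} [Fintype ι] {q : ℝ} {p : ι → ℝ}
    {a : ι → ℤ → ℝ} {u : ι → Aˣ} (hq : 0 < q) (hq1 : q ≤ 1) (hp : ∀ m, 0 < p m)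
    (hsum : ∑ m, p m = 1 - q) (ha : ∀ m, IsStep (a m))
    (hu : ∀ m, ∀ k : ℤ, ‖((u m ^ k : Aˣ) : A)‖ ≤ 1) {n : ℕ} (hn : 1 ≤ n) :
    ‖(1 + ∑ m, p m • (ev (u m) (a m) - 1)) ^ n -
        NormedSpace.exp ((n : ℝ) • ∑ m, p m • (ev (u m) (a m) - 1))‖ / 2 ≤
      1.76 / n * (∑ m, √(1 + stepSigma (a m))) ^ 2 *
        (1 + mainConst / (√n * q ^ 5) * ∑ m, √(1 + stepSigma (a m))) := by
  classical
  have hX : ∀ m, ‖ev (u m) (a m)‖ ≤ 1 := fun m => (ha m).norm_ev_le_one (hu m)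
  set X := fun m => ev (u m) (a m) with hXdef
  have hnorm : ∀ s : Finset ι, ‖∑ m ∈ s, p m • X m‖ ≤ ∑ m ∈ s, p m := fun s => by
    refine norm_sum_le_of_le _ fun m _ => ?_
    rw [norm_smul, Real.norm_eq_abs, abs_of_pos (hp m)]
    exact mul_le_of_le_one_right (hp m).le (hX m)
  have hW : ∑ m, p m • (X m - 1) = ∑ m, p m • X m - (1 - q) • (1 : A) := by
    simp only [smul_sub, Finset.sum_sub_distrib]
    rw [← Finset.sum_smul, hsum]
  have hrest : ∀ m, ∑ k ∈ Finset.univ.erase m, p k = 1 - (q + p m) := fun m => by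
    have := Finset.add_sum_erase Finset.univ p (Finset.mem_univ m)
    linarith
  have hsplit : ∀ m, ∑ k, p k • X k = p m • X m + ∑ k ∈ Finset.univ.erase m, p k • X k := fun m =>
    (Finset.add_sum_erase Finset.univ (fun k => p k • X k) (Finset.mem_univ m)).symm
  have hsum1 : ∀ y : A, (∑ m, p m • (X m - 1)) * y = ∑ m, p m • (X m - 1) * y := fun y =>
    Finset.sum_mul _ _ _
  refine norm_mixture_sub_exp_le hq hq1 (Finset.sum_nonneg fun m _ => Real.sqrt_nonneg _) ?_
    (fun t ht => ?_) (fun i => ?_) (fun t ht => ?_) hn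
  · have e : 1 + ∑ m, p m • (X m - 1) = q • (1 : A) + ∑ m, p m • X m := by
      rw [hW, sub_smul, one_smul]; abel
    rw [e]
    calc _ ≤ q + (1 - q) := by
          refine (norm_add_le _ _).trans (add_le_add ?_ ((hnorm _).trans_eq hsum))
          rw [norm_smul, norm_one, Real.norm_eq_abs, abs_of_pos hq, mul_one]
      _ = 1 := by ring
  · rw [hW]
    exact norm_exp_smul_sub_le_one ((hnorm _).trans_eq hsum) ht
  -- Each summand of `W` is smoothed by its own direction, all other directions being collected in a
  -- remainder of norm at most `1 - (q + p m)`.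
  · rw [hsum1, Finset.mul_sum, Finset.sum_div, Finset.sum_div]
    refine norm_sum_le_of_le _ fun m _ => ?_
    have e : 1 + ∑ m, p m • (X m - 1) =
        q • (1 : A) + p m • X m + ∑ k ∈ Finset.univ.erase m, p k • X k := by
      rw [hW, hsplit m, sub_smul, one_smul]; abel
    rw [e]
    exact (ha m).norm_diff_mul_pow_mixture_le (hu m) (hp m) hq ((hnorm _).trans_eq (hrest m)) i
  · rw [hsum1, Finset.mul_sum, Finset.sum_div]
    refine norm_sum_le_of_le _ fun m _ => ?_
    have e : ∑ m, p m • (X m - 1) = p m • (X m - 1) +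
        (∑ k ∈ Finset.univ.erase m, p k • X k - (1 - (q + p m)) • 1) := by
      rw [hW, hsplit m, smul_sub]
      simp only [sub_smul, add_smul]
      abel
    rw [e]
    exact (ha m).norm_diff_mul_exp_mixture_le (hu m) (hp m) ht ((hnorm _).trans_eq (hrest m))

theorem mul_one_add_mixture {A : Type*} [CommRing A] [Algebra ℝ A] {ι : Type*} [Fintype ι]
    {q : ℝ} {p : ι → ℝ} (x : A) (X : ι → A) (hsum : ∑ m, p m = 1 - q) :
    x * (1 + ∑ m, p m • (X m - 1)) = q • x + ∑ m, p m • (x * X m) := by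
  simp only [smul_sub, Finset.sum_sub_distrib]
  rw [← Finset.sum_smul, hsum]
  simp only [mul_add, mul_sub, Finset.mul_sum, mul_smul_comm, sub_smul, one_smul, mul_one]
  abel

/-! ### Distributions carried by the multiples of one vector. -/

section Line

set_option linter.unusedSectionVars false

variable {E : Type*} [NormedAddCommGroup E] [NormedSpace ℝ E] [MeasurableSpace E] [BorelSpace E]
  [SecondCountableTopology E]

theorem int_smul_injective {y : E} (hy : y ≠ 0) : Function.Injective fun k : ℤ => (k : ℝ) • y :=
  fun _ _ h => by exact_mod_cast smul_left_injective ℝ hy h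

/-- Integration against a distribution carried by the multiples of a vector. -/
theorem integral_line {μ : Measure E} {y : E} (hy : y ≠ 0)
    (hsupp : μ.support ⊆ {x | ∃ k : ℤ, k ≠ 0 ∧ x = (k : ℝ) • y}) {g : E → ℝ}
    (hg : Integrable g μ) :
    ∫ x, g x ∂μ = ∑' k : ℤ, μ.real {(k : ℝ) • y} * g ((k : ℝ) • y) := by
  set S := Set.range fun k : ℤ => (k : ℝ) • y
  have hS : S.Countable := Set.countable_range _
  have h0 : μ Sᶜ = 0 := by
    refine measure_mono_null (Set.compl_subset_compl.2 fun x hx => ?_) Measure.measure_compl_support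
    obtain ⟨k, -, rfl⟩ := hsupp hx
    exact ⟨k, rfl⟩
  have h1 : ∫ x in S, g x ∂μ = ∫ x, g x ∂μ := by
    rw [Measure.restrict_eq_self_of_ae_mem (compl_mem_ae_iff.1 (by rwa [compl_compl]))]
  rw [← h1, setIntegral_countable g hS hg.integrableOn,
    ← (Equiv.ofInjective _ (int_smul_injective hy)).tsum_eq]
  rfl

theorem isStep_line {μ : Measure E} [IsProbabilityMeasure μ] {y : E} (hy : y ≠ 0)
    (hsupp : μ.support ⊆ {x | ∃ k : ℤ, k ≠ 0 ∧ x = (k : ℝ) • y})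
    (hsymm : ∀ k : ℕ, 1 ≤ k → μ {(k : ℝ) • y} = μ {-((k : ℝ) • y)})
    (hvar : Summable fun k : ℤ => (k : ℝ) ^ 2 * μ.real {(k : ℝ) • y}) :
    IsStep fun k : ℤ => μ.real {(k : ℝ) • y} where
  nonneg _ := measureReal_nonneg
  hasSum := by
    have h1 := integral_line hy hsupp (integrable_const (1 : ℝ))
    have h2 : Summable fun k : ℤ => μ.real {(k : ℝ) • y} := by
      rw [← Equiv.intEquivNat.symm.summable_iff]
      refine summable_measure_toReal (μ := μ)
        (f := fun j : ℕ => {((Equiv.intEquivNat.symm j : ℤ) : ℝ) • y})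
        (fun _ => measurableSet_singleton _) fun i j hij => ?_
      rw [Function.onFun, Set.disjoint_singleton]
      exact (int_smul_injective hy).ne (Equiv.intEquivNat.symm.injective.ne hij)
    simp only [integral_const, mul_one, probReal_univ, smul_eq_mul] at h1
    rw [h1]
    exact h2.hasSum
  zero := by
    have : ({((0 : ℤ) : ℝ) • y} : Set E) ⊆ μ.supportᶜ := by
      rw [Set.singleton_subset_iff]
      intro h
      obtain ⟨k, hk, h⟩ := hsupp h
      exact hk (int_smul_injective hy h).symm
    rw [measureReal_def, measure_mono_null this Measure.measure_compl_support,
      ENNReal.toReal_zero]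
  symm k := by
    have key : ∀ j : ℕ, μ.real {((-(j : ℤ) : ℤ) : ℝ) • y} = μ.real {((j : ℤ) : ℝ) • y} := by
      intro j
      rcases Nat.eq_zero_or_pos j with rfl | hj
      · simp
      · have := hsymm j hj
        rw [measureReal_def, measureReal_def]
        push_cast
        rw [neg_smul, this]
    obtain ⟨j, rfl | rfl⟩ := k.eq_nat_or_neg
    · exact key j
    · rw [neg_neg]; exact (key j).symm
  summable_sq := hvar

end Line

/-! ### From operators back to measures. -/

section Bridge

set_option linter.unusedSectionVars false

variable {E : Type*} [NormedAddCommGroup E] [NormedSpace ℝ E] [MeasurableSpace E] [BorelSpace E]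
  [SecondCountableTopology E]

/-- The operator `x` represents the signed measure `M`. -/
def Represents (M : SignedMeasure E) (x : TransAlg E) : Prop :=
  ∀ B : Set E, MeasurableSet B → M B = mass B x

theorem represents_unitMass : Represents (unitMass (0 : E)) 1 := by
  intro B hB
  rw [mass_one, unitMass, Measure.toSignedMeasure_apply_measurable hB, measureReal_def,
    Measure.dirac_apply' _ hB]
  by_cases h : (0 : E) ∈ B <;> simp [h]

theorem mass_mul_ev (B : Set E) (x : TransAlg E) (y : E) {c : ℤ → ℝ}
    (hc : Summable fun k => |c k|) :
    mass B (x * ev (translateUnit y) c) =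
      ∑' k : ℤ, c k * mass ((fun z => z + (k : ℝ) • y) ⁻¹' B) x := by
  have h := ((hasSum_ev (norm_translateUnit_zpow_le y) hc).mul_left x).mapL (mass B)
  rw [← h.tsum_eq]
  refine tsum_congr fun k => ?_
  rw [mul_smul_comm, map_smul, smul_eq_mul, translateUnit_zpow, mass_mul_translateUnit,
    Int.cast_smul_eq_zsmul]

variable {ι : Type*} [Fintype ι] {F : Measure E} [IsProbabilityMeasure F] {q : ℝ} {p : ι → ℝ}
  {Fm : ι → Measure E} [∀ m, IsProbabilityMeasure (Fm m)] {y : ι → E}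

/-- Convolution with `F` averages the translates of `M`: the atom at zero gives `q x`, and each
`F_m` gives a series of translations by multiples of `y_m`, which is multiplication by its Laurent
series. -/
theorem Represents.conv_mixture {M : SignedMeasure E} {x : TransAlg E} (h : Represents M x)
    (hq : 0 ≤ q) (hp : ∀ m, 0 ≤ p m) (hsum : ∑ m, p m = 1 - q)
    (hF : F = ENNReal.ofReal q • Measure.dirac 0 + ∑ m, ENNReal.ofReal (p m) • Fm m)
    (hy : ∀ m, y m ≠ 0)
    (hsupp : ∀ m, (Fm m).support ⊆ {x | ∃ k : ℤ, k ≠ 0 ∧ x = (k : ℝ) • y m})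
    (ha : ∀ m, IsStep fun k : ℤ => (Fm m).real {(k : ℝ) • y m}) :
    Represents (conv M F.toSignedMeasure) (x * (1 + ∑ m, p m •
      (ev (translateUnit (y m)) (fun k : ℤ => (Fm m).real {(k : ℝ) • y m}) - 1))) := by
  intro B hB
  have hint := fun (μ : Measure E) [IsFiniteMeasure μ] => integrable_translate M hB μ
  have hFi : ∫ z, M ((fun x => x + z) ⁻¹' B) ∂F = q * M B +
      ∑ m, p m * ∫ z, M ((fun x => x + z) ⁻¹' B) ∂(Fm m) := by
    rw [hF, integral_add_measure ((hint _).smul_measure ENNReal.ofReal_ne_top)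
      (integrable_finsetSum_measure.2 fun m _ => (hint _).smul_measure ENNReal.ofReal_ne_top),
      integral_finsetSum_measure fun m _ => (hint _).smul_measure ENNReal.ofReal_ne_top,
      integral_smul_measure, integral_dirac' _ _ (measurable_translate M hB),
      ENNReal.toReal_ofReal hq]
    simp only [integral_smul_measure, ENNReal.toReal_ofReal (hp _), smul_eq_mul, add_zero,
      Set.preimage_id']
  have hW : x * (1 + ∑ m, p m •
      (ev (translateUnit (y m)) (fun k : ℤ => (Fm m).real {(k : ℝ) • y m}) - 1)) =
      q • x + ∑ m, p m •
        (x * ev (translateUnit (y m)) (fun k : ℤ => (Fm m).real {(k : ℝ) • y m})) :=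
    mul_one_add_mixture x _ hsum
  rw [conv_toSignedMeasure_apply M F hB, hFi, hW, map_add, map_sum, map_smul, smul_eq_mul, h B hB]
  congr 1
  refine Finset.sum_congr rfl fun m _ => ?_
  rw [map_smul, smul_eq_mul, mass_mul_ev _ _ _ (ha m).summable_abs_coeff,
    integral_line (hy m) (hsupp m) (hint _)]
  congr 1
  refine tsum_congr fun k => ?_
  rw [h _ (measurable_add_const _ hB)]

/-- The hypothesis covers every representable `M`, so induction from the unit mass suffices and
associativity of `conv` never enters. -/
theorem represents_convPow {V : SignedMeasure E} {v : TransAlg E}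
    (h : ∀ M x, Represents M x → Represents (conv M V) (x * v)) (n : ℕ) :
    Represents (convPow V n) (v ^ n) := by
  induction n with
  | zero => rw [pow_zero]; exact represents_unitMass
  | succ n ih => rw [pow_succ]; exact h _ _ ih

theorem represents_expMeasure {V : SignedMeasure E} {v : TransAlg E}
    (h : ∀ M x, Represents M x → Represents (conv M V) (x * v)) :
    Represents (expMeasure V) (NormedSpace.exp v) := by
  intro B hB
  have h1 := (hasSum_exp_real v).mapL (mass B)
  rw [← h1.tsum_eq]
  change ∑' j : ℕ, convPow V j B / (j ! : ℝ) = _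
  refine tsum_congr fun j => ?_
  rw [map_smul, smul_eq_mul, represents_convPow h j B hB, div_eq_inv_mul]

/-- The total variation distance is at most half of the norm of the representing operator. -/
theorem tvDist_le_norm {M V : SignedMeasure E} {x v : TransAlg E} (hM : Represents M x)
    (hV : Represents V v) (huniv : M Set.univ = V Set.univ) : tvDist M V ≤ ‖x - v‖ / 2 := by
  have h0 : mass Set.univ (x - v) = 0 := by
    rw [map_sub, ← hM _ MeasurableSet.univ, ← hV _ MeasurableSet.univ, huniv, sub_self]
  have : Nonempty {B : Set E // MeasurableSet B} := ⟨⟨∅, MeasurableSet.empty⟩⟩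
  refine ciSup_le fun B => ?_
  rw [hM _ B.2, hV _ B.2, ← map_sub]
  exact abs_mass_le h0 B

theorem conv_univ (M V : SignedMeasure E) :
    conv M V Set.univ = M Set.univ * V Set.univ := by
  have hadd : Measurable fun z : E × E => z.1 + z.2 := measurable_fst.add measurable_snd
  rw [conv, VectorMeasure.map_apply _ hadd MeasurableSet.univ,
    Set.preimage_univ, ← Set.univ_prod_univ, VectorMeasure.prod_apply]
  rfl

theorem convPow_univ (M : SignedMeasure E) (n : ℕ) : convPow M n Set.univ = M Set.univ ^ n := by
  induction n with
  | zero => simp [convPow, unitMass]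
  | succ n ih => rw [convPow, conv_univ, ih, pow_succ]

end Bridge

end ConvExp

theorem theorem8 :
    ∃ C : ℝ, 0 < C ∧
      ∀ (d K : ℕ) (_ : d ≤ K)
        (F : Measure (EuclideanSpace ℝ (Fin d))) [IsProbabilityMeasure F]
        (q : ℝ) (p : Fin K → ℝ)
        (Fm : Fin K → Measure (EuclideanSpace ℝ (Fin d))) [∀ m, IsProbabilityMeasure (Fm m)]
        (y : Fin K → EuclideanSpace ℝ (Fin d)),
        -- the mixture `F = q I + ∑ p_m F_m`
        q ∈ Set.Ioo (0 : ℝ) 1 →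
        (∀ m, p m ∈ Set.Ioo (0 : ℝ) 1) →
        ∑ m, p m = 1 - q →
        F = ENNReal.ofReal q • Measure.dirac 0 + ∑ m, ENNReal.ofReal (p m) • Fm m →
        -- `F_m` lives on the nonzero integer multiples of `y_m`, and the supports are disjoint
        (∀ m, y m ≠ 0) →
        (∀ m, (Fm m).support ⊆ {x | ∃ k : ℤ, k ≠ 0 ∧ x = (k : ℝ) • y m}) →
        (∀ m k, k ≠ m → (Fm m).support ∩ (Fm k).support = ∅) →
        -- symmetry
        (∀ m, ∀ k : ℕ, 1 ≤ k → Fm m {(k : ℝ) • y m} = Fm m {-((k : ℝ) • y m)}) →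
        -- two consecutive multiples of `y_m` are charged
        (∀ m, ∃ k : ℤ, 0 < Fm m {(k : ℝ) • y m} ∧ 0 < Fm m {((k : ℝ) + 1) • y m}) →
        -- finite variances
        (∀ m, Summable fun k : ℤ => (k : ℝ) ^ 2 * (Fm m).real {(k : ℝ) • y m}) →
        ∀ n : ℕ, 1 ≤ n →
          ConvExp.tvDist (ConvExp.convPow F.toSignedMeasure n)
              (ConvExp.expMeasure ((n : ℝ) • (F.toSignedMeasure - ConvExp.unitMass 0))) ≤
            1.76 / n * (∑ m, √(1 + ConvExp.lineSigma (Fm m) (y m))) ^ 2 *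
              (1 + C / (√n * q ^ 5) * ∑ m, √(1 + ConvExp.lineSigma (Fm m) (y m))) := by
  refine ⟨ConvExp.mainConst, by unfold ConvExp.mainConst; norm_num, ?_⟩
  intro d K _ F _ q p Fm _ y hq hp hsum hF hy hsupp _ hsymm _ hvar n hn
  have ha := fun m => ConvExp.isStep_line (hy m) (hsupp m) (hsymm m) (hvar m)
  have hstep := fun M x (h : ConvExp.Represents M x) => h.conv_mixture (F := F) hq.1.le
    (fun m => (hp m).1.le) hsum hF hy hsupp ha
  set W := ∑ m, p m • (ConvExp.ev (ConvExp.translateUnit (y m))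
    (fun k : ℤ => (Fm m).real {(k : ℝ) • y m}) - 1) with hW
  have hstep' : ∀ M x, ConvExp.Represents M x → ConvExp.Represents
      (ConvExp.conv M ((n : ℝ) • (F.toSignedMeasure - ConvExp.unitMass 0))) (x * (n : ℝ) • W) := by
    intro M x h B hB
    rw [ConvExp.conv_smul_sub_apply _ _ _ _ hB, ConvExp.conv_unitMass_zero_apply _ hB,
      hstep M x h B hB, h B hB, mul_smul_comm, map_smul, smul_eq_mul, mul_add, mul_one, map_add]
    ring
  refine (ConvExp.tvDist_le_norm (ConvExp.represents_convPow hstep n)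
    (ConvExp.represents_expMeasure hstep') ?_).trans
    (ConvExp.norm_mixture_pow_sub_exp_le hq.1 hq.2.le (fun m => (hp m).1) hsum ha
      (fun m => ConvExp.norm_translateUnit_zpow_le (y m)) hn)
  -- Both measures have total mass `1`: `n(F - I)` has mass zero, so only the term `j = 0` of the
  -- exponential series contributes.
  have hF1 : F.toSignedMeasure Set.univ = 1 := by
    rw [Measure.toSignedMeasure_apply_measurable MeasurableSet.univ, probReal_univ]
  have hV : ((n : ℝ) • (F.toSignedMeasure - ConvExp.unitMass 0) : SignedMeasure _) Set.univ =
      0 := by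
    simp [hF1, ConvExp.unitMass]
  rw [ConvExp.convPow_univ, hF1, one_pow]
  change 1 = ∑' j : ℕ, ConvExp.convPow _ j Set.univ / (j ! : ℝ)
  rw [tsum_eq_single 0 fun j hj => by rw [ConvExp.convPow_univ, hV, zero_pow hj, zero_div]]
  rw [ConvExp.convPow_univ]; simp
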